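/- Call a metric space $U$ a bounded Urysohn space of diameter $1$ if it is complete and separable, has diameter $1$, is homogeneous in the sense that every isometric embedding of a finite subset of $U$ into $U$ extends to an isometry of $U$ onto itself, and every finite metric space of diameter at most $1$ embeds isometrically into $U$. Theorem. Such a space exists, and for every such space $U$ (it is well known that $U$ is determined up to isometry; it is denoted $\mathbb U_1$) the group $\mathrm{Isom}(U)$ of all isometries of $U$ onto itself, with composition as multiplication, is simple as an abstract group: it is nontrivial, and its only normal subgroups are the trivial subgroup and the whole group. -/

import Mathlib

/-- A metric space `U` is *ultrahomogeneous* if every isometric embedding of a finite subset of `U`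
into `U` extends to an isometry of `U` onto itself. -/
def IsUltrahomogeneousMetric (U : Type*) [MetricSpace U] : Prop :=
  ∀ (A : Set U) (f : A → U), A.Finite → Isometry f → ∃ g : U ≃ᵢ U, ∀ a : A, g a = f a

/-- The defining properties of the bounded Urysohn space of diameter `1`: it is a complete,
separable, (ultra)homogeneous metric space of diameter `1` into which every finite metric space
of diameter at most `1` embeds isometrically. -/
structure IsBoundedUrysohnSpace (U : Type*) [MetricSpace U] : Prop where
  complete : CompleteSpace U
  separable : TopologicalSpace.SeparableSpace U
  diam_eq_one : Metric.diam (Set.univ : Set U) = 1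
  homogeneous : IsUltrahomogeneousMetric U
  embeds_finite : ∀ (F : Type) [MetricSpace F] [Finite F],
    Metric.diam (Set.univ : Set F) ≤ 1 → ∃ f : F → U, Isometry f

/-!
# The isometry group of the bounded Urysohn space is simple

Everything rests on the extension property: over a finite set, every function satisfying the
inequalities of a distance to a new point (a Katětov function with values in `[0, 1]`) is realized
by a point. A bounded Urysohn space has this property, because the finite space extended by one
point embeds and homogeneity moves the embedded copy into place; conversely a complete separable
space with the extension property is homogeneous by back-and-forth.

*Existence.* A countable pseudometric space that solves all rational one-point extension problems
has a completion with the extension property (`exists_isBoundedUrysohnSpace`).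

*Simplicity.* Let `N` be a nontrivial normal subgroup.

* Some `t ∈ N` moves every point by exactly `1` (`exists_mem_normal_dist_eq_one`). It is
  a product of conjugates of a nontrivial element of `N` and its inverse, obtained from
  isometries built by back-and-forth.
* If `s` moves every point by `1`, a finite partial isometry `x ↦ y x` is a restriction of
  a conjugate `k * s * k⁻¹` with `k` almost the identity on a finite set `A`, as soon as the
  distances between its domain and its image are the largest ones compatible with the behaviour
  of `s` on `A`, up to a small error (`perturbDist`, `exists_conj_eq_on`). Amalgamating three such
  partial isometries with enough freedom in the two intermediate images shows that products of
  conjugates of `t`, `t` and `t⁻¹` are somewhere dense, with the conjugating elements confined to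
  any given open set (`exists_conj_mul_eq_on`, `interior_closure_conjProduct_nonempty`).
* Being dense with somewhere dense images of open sets is enough for a zigzag argument in the
  completely metrizable group of isometries: the map `h ↦ conjProduct t h` and its translate by any
  isometry `f` have a common value (`exists_eq_of_somewhere_dense`). So every `f` is a quotient of
  two such products, and `f ∈ N`.
-/

/-! ### Katětov functions and free extensions -/

/-- A Katětov function with values in `[0, 1]`: the distances to all points of `U` that a further
point could have in a metric space of diameter at most `1` containing `U`. -/
structure IsKatetov {U : Type*} [MetricSpace U] (p : U → ℝ) : Prop where
  le_one : ∀ u, p u ≤ 1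
  lip : ∀ u v, p u ≤ p v + dist u v
  dist_le : ∀ u v, dist u v ≤ p u + p v

theorem IsKatetov.nonneg {U : Type*} [MetricSpace U] {p : U → ℝ} (hp : IsKatetov p) (u : U) :
    0 ≤ p u := by
  have := hp.dist_le u u
  rw [dist_self] at this
  linarith

/-- The extension property of the bounded Urysohn space: every Katětov function is realized by a
point on every finite set. -/
def ExtensionProperty (U : Type*) [MetricSpace U] : Prop :=
  ∀ p : U → ℝ, IsKatetov p → ∀ F : Set U, F.Finite → ∃ x, ∀ u ∈ F, dist x u = p u

/-- The infimum of a family of reals capped at `1`. The index `none` stands for the cap, so that the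
family may be empty. -/
noncomputable def cappedInf {ι : Type*} (c : ι → ℝ) : ℝ :=
  ⨅ o : Option ι, o.elim 1 c

theorem le_cappedInf {ι : Type*} {c : ι → ℝ} {r : ℝ} (h1 : r ≤ 1) (h : ∀ i, r ≤ c i) :
    r ≤ cappedInf c := by
  refine le_ciInf fun o => ?_
  cases o with
  | none => exact h1
  | some i => exact h i

theorem cappedInf_le_one {ι : Type*} [Finite ι] (c : ι → ℝ) : cappedInf c ≤ 1 :=
  ciInf_le (Set.finite_range _).bddBelow (none : Option ι)

theorem cappedInf_le {ι : Type*} [Finite ι] (c : ι → ℝ) (i : ι) : cappedInf c ≤ c i :=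
  ciInf_le (Set.finite_range fun o : Option ι => o.elim 1 c).bddBelow (some i)

theorem cappedInf_cases {ι : Type*} [Finite ι] (c : ι → ℝ) :
    cappedInf c = 1 ∨ ∃ i, cappedInf c = c i := by
  obtain ⟨o, ho⟩ := exists_eq_ciInf_of_finite (f := fun o : Option ι => o.elim 1 c)
  cases o with
  | none => exact Or.inl ho.symm
  | some i => exact Or.inr ⟨i, ho.symm⟩

/-- The largest `1`-Lipschitz function with values at most `1` that is at most `w i` at `a i`. -/
noncomputable def freeExt {U ι : Type*} [MetricSpace U] (a : ι → U) (w : ι → ℝ) (u : U) : ℝ :=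
  cappedInf fun i => w i + dist (a i) u

section FreeExt

variable {U ι : Type*} [MetricSpace U] {a : ι → U} {w : ι → ℝ}

theorem le_freeExt {r : ℝ} {u : U} (h1 : r ≤ 1) (h : ∀ i, r ≤ w i + dist (a i) u) :
    r ≤ freeExt a w u :=
  le_cappedInf h1 h

variable [Finite ι]

theorem freeExt_le_one (u : U) : freeExt a w u ≤ 1 :=
  cappedInf_le_one _

theorem freeExt_le (i : ι) (u : U) : freeExt a w u ≤ w i + dist (a i) u :=
  cappedInf_le (fun i => w i + dist (a i) u) i

theorem freeExt_le_weight (i : ι) : freeExt a w (a i) ≤ w i := by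
  have := freeExt_le (a := a) (w := w) i (a i)
  rwa [dist_self, add_zero] at this

theorem freeExt_cases (a : ι → U) (w : ι → ℝ) (u : U) :
    freeExt a w u = 1 ∨ ∃ i, freeExt a w u = w i + dist (a i) u :=
  cappedInf_cases _

theorem isKatetov_freeExt (hU : ∀ x y : U, dist x y ≤ 1)
    (h : ∀ i j, dist (a i) (a j) ≤ w i + w j) : IsKatetov (freeExt a w) := by
  have h0 : ∀ i, 0 ≤ w i := fun i => by
    have := h i i
    rw [dist_self] at this
    linarith
  have hn : ∀ u, 0 ≤ freeExt a w u := fun u =>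
    le_freeExt zero_le_one fun i => add_nonneg (h0 i) dist_nonneg
  refine ⟨freeExt_le_one, fun u v => ?_, fun u v => ?_⟩
  · rcases freeExt_cases a w v with hv | ⟨i, hv⟩
    · have := freeExt_le_one (a := a) (w := w) u
      linarith [dist_nonneg (x := u) (y := v)]
    · have := freeExt_le (a := a) (w := w) i u
      linarith [dist_triangle (a i) v u, dist_comm u v]
  · rcases freeExt_cases a w v with hv | ⟨i, hv⟩
    · linarith [hn u, hU u v]
    rcases freeExt_cases a w u with hu | ⟨j, hu⟩
    · linarith [hn v, hU u v]
    linarith [h i j, dist_triangle4_left u v (a i) (a j), dist_comm (a i) v,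
      dist_triangle4 u (a j) (a i) v, dist_comm u (a j), dist_comm (a i) (a j)]

end FreeExt

/-! ### Extending densely defined isometries; the back-and-forth construction -/

section BackAndForth

variable {U : Type*} [MetricSpace U]

/-- A relation between points of a metric space that preserves distances. -/
def IsometricRel (R : Set (U × U)) : Prop :=
  ∀ x ∈ R, ∀ y ∈ R, dist x.1 y.1 = dist x.2 y.2

theorem IsometricRel.swap {R : Set (U × U)} (hR : IsometricRel R) :
    IsometricRel (Prod.swap '' R) := by
  rintro _ ⟨x, hx, rfl⟩ _ ⟨y, hy, rfl⟩
  exact (hR x hx y hy).symm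

theorem IsometricRel.exists_map [CompleteSpace U] {R : Set (U × U)} (hR : IsometricRel R)
    (h1 : Dense (Prod.fst '' R)) :
    ∃ g : U → U, Isometry g ∧ ∀ x ∈ R, g x.1 = x.2 := by
  let i : (Prod.fst '' R) → U := Subtype.val
  choose f hf hf' using fun y : (Prod.fst '' R) => y.2
  have hi : IsUniformInducing i := isUniformInducing_val _
  have hd : DenseRange i := h1.denseRange_val
  let k : (Prod.fst '' R) → U := fun y => (f y).2
  have hk : Isometry k := Isometry.of_dist_eq fun y z => by
    rw [Subtype.dist_eq, ← hf' y, ← hf' z]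
    exact (hR _ (hf y) _ (hf z)).symm
  let g := (hi.isDenseInducing hd).extend k
  have hgu : UniformContinuous g := uniformContinuous_uniformly_extend hi hd hk.uniformContinuous
  have hgi : ∀ y, g (i y) = k y := fun y => uniformly_extend_of_ind hi hd hk.uniformContinuous y
  have hg : Isometry g := by
    refine Isometry.of_dist_eq fun x y => ?_
    refine hd.induction_on₂ (p := fun x y => dist (g x) (g y) = dist x y) ?_ ?_ x y
    · exact isClosed_eq ((hgu.continuous.comp continuous_fst).dist
        (hgu.continuous.comp continuous_snd)) (continuous_fst.dist continuous_snd)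
    · intro a b
      rw [hgi, hgi, hk.dist_eq, Subtype.dist_eq]
  refine ⟨g, hg, fun x hx => ?_⟩
  have h2 := hgi ⟨x.1, x, hx, rfl⟩
  have h3 : dist (f ⟨x.1, x, hx, rfl⟩).2 x.2 = 0 := by
    rw [← hR _ (hf ⟨x.1, x, hx, rfl⟩) x hx, hf', dist_self]
  exact h2.trans (dist_eq_zero.1 h3)

/-- A distance-preserving relation with dense domain and dense range is contained in the graph of
an isometry of a complete space onto itself. -/
theorem IsometricRel.exists_isometryEquiv [CompleteSpace U] {R : Set (U × U)}
    (hR : IsometricRel R) (h1 : Dense (Prod.fst '' R)) (h2 : Dense (Prod.snd '' R)) :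
    ∃ g : U ≃ᵢ U, ∀ x ∈ R, g x.1 = x.2 := by
  obtain ⟨g, hg, hgR⟩ := hR.exists_map h1
  obtain ⟨k, hk, hkR⟩ := hR.swap.exists_map (by
    rwa [Set.image_image])
  have hkg : ∀ x ∈ R, k (g x.1) = x.1 := fun x hx => by
    rw [hgR x hx]
    exact hkR _ ⟨x, hx, rfl⟩
  have hgk : ∀ x ∈ R, g (k x.2) = x.2 := fun x hx => by
    have h : k x.2 = x.1 := hkR x.swap ⟨x, hx, rfl⟩
    rw [h]
    exact hgR x hx
  have e1 : k ∘ g = id := Continuous.ext_on h1 (hk.continuous.comp hg.continuous) continuous_id (by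
    rintro _ ⟨x, hx, rfl⟩
    exact hkg x hx)
  have e2 : g ∘ k = id := Continuous.ext_on h2 (hg.continuous.comp hk.continuous) continuous_id (by
    rintro _ ⟨x, hx, rfl⟩
    exact hgk x hx)
  exact ⟨⟨⟨g, k, congrFun e1, congrFun e2⟩, hg⟩, hgR⟩

/-- Back-and-forth: a family of finite distance-preserving relations in which every point can be
added to the domain and to the range yields an isometry all of whose values on a dense set come
from members of the family. -/
theorem exists_isometryEquiv_of_backAndForth [CompleteSpace U]
    [TopologicalSpace.SeparableSpace U] [Nonempty U] (P : Set (U × U) → Prop)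
    (iso : ∀ R, P R → IsometricRel R)
    (forth : ∀ R, P R → ∀ w, ∃ v, P (insert (w, v) R))
    (back : ∀ R, P R → ∀ w, ∃ v, P (insert (v, w) R)) {R₀ : Set (U × U)} (h₀ : P R₀) :
    ∃ g : U ≃ᵢ U, (∀ x ∈ R₀, g x.1 = x.2) ∧
      ∃ D : Set U, Dense D ∧ ∀ b ∈ D, ∀ c ∈ D, ∃ R, P R ∧ (b, g b) ∈ R ∧ (c, g c) ∈ R := by
  have step : ∀ (w : U) (R : {R // P R}), ∃ R' : {R // P R}, R.1 ⊆ R'.1 ∧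
      (∃ v, (w, v) ∈ R'.1) ∧ (∃ v, (v, w) ∈ R'.1) := by
    rintro w ⟨R, hR⟩
    obtain ⟨v, hv⟩ := forth R hR w
    obtain ⟨v', hv'⟩ := back _ hv w
    refine ⟨⟨_, hv'⟩, ?_, ⟨v, ?_⟩, ⟨v', ?_⟩⟩
    · exact (Set.subset_insert _ _).trans (Set.subset_insert _ _)
    · exact Set.mem_insert_of_mem _ (Set.mem_insert _ _)
    · exact Set.mem_insert _ _
  choose nxt h1 h2 h3 using step
  let u := TopologicalSpace.denseSeq U
  have hu : DenseRange u := TopologicalSpace.denseRange_denseSeq U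
  let S : ℕ → {R // P R} := fun n => Nat.rec ⟨R₀, h₀⟩ (fun n R => nxt (u n) R) n
  have hS : Monotone fun n => (S n).1 := monotone_nat_of_le_succ fun n => h1 (u n) (S n)
  have hiso : IsometricRel (⋃ n, (S n).1) := by
    intro x hx y hy
    obtain ⟨n, hn⟩ := Set.mem_iUnion.1 hx
    obtain ⟨m, hm⟩ := Set.mem_iUnion.1 hy
    exact iso _ (S (max n m)).2 x (hS (le_max_left n m) hn) y (hS (le_max_right n m) hm)
  obtain ⟨g, hg⟩ := hiso.exists_isometryEquiv
    (hu.mono (by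
      rintro _ ⟨n, rfl⟩
      obtain ⟨v, hv⟩ := h2 (u n) (S n)
      exact ⟨_, Set.mem_iUnion.2 ⟨n + 1, hv⟩, rfl⟩))
    (hu.mono (by
      rintro _ ⟨n, rfl⟩
      obtain ⟨v, hv⟩ := h3 (u n) (S n)
      exact ⟨_, Set.mem_iUnion.2 ⟨n + 1, hv⟩, rfl⟩))
  refine ⟨g, fun x hx => hg x (Set.mem_iUnion.2 ⟨0, hx⟩), Set.range u, hu, ?_⟩
  have key : ∀ n, (u n, g (u n)) ∈ (S (n + 1)).1 := fun n => by
    obtain ⟨v, hv⟩ := h2 (u n) (S n)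
    have := hg _ (Set.mem_iUnion.2 ⟨n + 1, hv⟩)
    simp only at this
    rw [this]
    exact hv
  rintro _ ⟨n, rfl⟩ _ ⟨m, rfl⟩
  exact ⟨(S (max (n + 1) (m + 1))).1, (S _).2, hS (le_max_left _ _) (key n),
    hS (le_max_right _ _) (key m)⟩

end BackAndForth

/-! ### Transporting types; homogeneity -/

section Transport

variable {U : Type*} [MetricSpace U]

/-- The type over the range of `R` that corresponds to the type of `w` over the domain of `R`,
extended freely to all of `U`. -/
noncomputable def transport (R : Set (U × U)) (w : U) : U → ℝ :=
  freeExt (fun x : R => x.1.2) (fun x : R => dist w x.1.1)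

theorem transport_cases {R : Set (U × U)} (hf : R.Finite) (w u : U) :
    transport R w u = 1 ∨ ∃ x ∈ R, transport R w u = dist w x.1 + dist x.2 u := by
  have := hf.to_subtype
  rcases freeExt_cases (fun x : R => x.1.2) (fun x : R => dist w x.1.1) u with h | ⟨x, hx⟩
  · exact Or.inl h
  · exact Or.inr ⟨x.1, x.2, hx⟩

theorem isKatetov_transport (hU : ∀ x y : U, dist x y ≤ 1) {R : Set (U × U)} (hf : R.Finite)
    (hR : IsometricRel R) (w : U) : IsKatetov (transport R w) := by
  have := hf.to_subtype
  refine isKatetov_freeExt hU fun x y => ?_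
  rw [← hR _ x.2 _ y.2]
  exact dist_triangle_left _ _ _

theorem transport_eq (hU : ∀ x y : U, dist x y ≤ 1) {R : Set (U × U)} (hf : R.Finite)
    (hR : IsometricRel R) (w : U) {x : U × U} (hx : x ∈ R) :
    transport R w x.2 = dist w x.1 := by
  have := hf.to_subtype
  refine le_antisymm ?_ (le_freeExt (hU _ _) fun y => ?_)
  · exact freeExt_le_weight (a := fun x : R => x.1.2) (w := fun x : R => dist w x.1.1) ⟨x, hx⟩
  · rw [← hR _ y.2 _ hx]
    exact dist_triangle _ _ _

theorem IsometricRel.insert {R : Set (U × U)} (hR : IsometricRel R) {w v : U}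
    (h : ∀ x ∈ R, dist v x.2 = dist w x.1) : IsometricRel (insert (w, v) R) := by
  rintro x (rfl | hx) y (rfl | hy)
  · simp
  · exact (h y hy).symm
  · rw [dist_comm x.1, dist_comm x.2]
    exact (h x hx).symm
  · exact hR x hx y hy

theorem insert_of_image_swap {V : Type*} {R : Set (V × V)} {P : Set (V × V) → Prop} {v w : V}
    (h : P (Prod.swap '' (insert (w, v) (Prod.swap '' R)))) : P (insert (v, w) R) := by
  rwa [Set.image_insert_eq, Set.image_image, Set.image_congr (g := id) (fun x _ => Prod.swap_swap x),
    Set.image_id] at h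

theorem isometricRel_range {ι : Type*} {a b : ι → U}
    (h : ∀ i j, dist (a i) (a j) = dist (b i) (b j)) :
    IsometricRel (Set.range fun i => (a i, b i)) := by
  rintro _ ⟨i, rfl⟩ _ ⟨j, rfl⟩
  exact h i j

/-- Homogeneity, from the extension property by back-and-forth. -/
theorem ExtensionProperty.isUltrahomogeneousMetric [CompleteSpace U]
    [TopologicalSpace.SeparableSpace U] (hU : ∀ x y : U, dist x y ≤ 1)
    (hE : ExtensionProperty U) : IsUltrahomogeneousMetric U := by
  intro A f hA hf
  rcases isEmpty_or_nonempty U with hemp | hne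
  · exact ⟨IsometryEquiv.refl U, fun a => (hemp.false a.1).elim⟩
  have := hA.to_subtype
  let P : Set (U × U) → Prop := fun R => R.Finite ∧ IsometricRel R
  have forth : ∀ R, P R → ∀ w, ∃ v, P (insert (w, v) R) := by
    rintro R ⟨hfin, hR⟩ w
    obtain ⟨v, hv⟩ := hE _ (isKatetov_transport hU hfin hR w) (Prod.snd '' R) (hfin.image _)
    refine ⟨v, hfin.insert _, hR.insert fun x hx => ?_⟩
    rw [hv _ ⟨x, hx, rfl⟩, transport_eq hU hfin hR w hx]
  have hsw : ∀ R, P R → P (Prod.swap '' R) := fun R hR => ⟨hR.1.image _, hR.2.swap⟩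
  obtain ⟨g, hg, -⟩ := exists_isometryEquiv_of_backAndForth P (fun R h => h.2) forth
    (fun R hR w => by
      obtain ⟨v, hv⟩ := forth _ (hsw R hR) w
      exact ⟨v, insert_of_image_swap (hsw _ hv)⟩)
    (R₀ := Set.range fun a : A => ((a : U), f a))
    ⟨Set.finite_range _, isometricRel_range fun i j => (hf.dist_eq i j).symm⟩
  exact ⟨g, fun a => hg _ ⟨a, rfl⟩⟩

theorem IsUltrahomogeneousMetric.exists_isometryEquiv (hH : IsUltrahomogeneousMetric U)
    {ι : Type*} [Finite ι] (a b : ι → U) (h : ∀ i j, dist (a i) (a j) = dist (b i) (b j)) :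
    ∃ g : U ≃ᵢ U, ∀ i, g (a i) = b i := by
  choose k hk using fun x : Set.range a => x.2
  obtain ⟨g, hg⟩ := hH (Set.range a) (fun x => b (k x)) (Set.finite_range a)
    (Isometry.of_dist_eq fun x y => by rw [← h, hk, hk, Subtype.dist_eq])
  refine ⟨g, fun i => ?_⟩
  rw [hg ⟨a i, i, rfl⟩, ← dist_eq_zero, ← h, hk, dist_self]

end Transport

/-! ### Bounded Urysohn spaces and the extension property -/

section Urysohn

variable {U : Type*} [MetricSpace U]

theorem IsBoundedUrysohnSpace.dist_le_one (h : IsBoundedUrysohnSpace U) (x y : U) :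
    dist x y ≤ 1 := by
  have hb : Bornology.IsBounded (Set.univ : Set U) := by
    by_contra hb
    have := Metric.diam_eq_zero_of_unbounded hb
    rw [h.diam_eq_one] at this
    exact one_ne_zero this
  rw [← h.diam_eq_one]
  exact Metric.dist_le_diam_of_mem hb (Set.mem_univ _) (Set.mem_univ _)

/-- The finite metric space obtained by adding to finitely many points `a i` of `U` one point at
prescribed positive distances `f i`. -/
abbrev onePointExtension {n : ℕ} (a : Fin n → U) (ha : Function.Injective a) (f : Fin n → ℝ)
    (hpos : ∀ i, 0 < f i) (hlip : ∀ i j, f i ≤ f j + dist (a i) (a j))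
    (hdist : ∀ i j, dist (a i) (a j) ≤ f i + f j) : MetricSpace (Option (Fin n)) where
  dist
    | none, none => 0
    | none, some i => f i
    | some i, none => f i
    | some i, some j => dist (a i) (a j)
  dist_self
    | none => rfl
    | some i => dist_self (a i)
  dist_comm
    | none, none => rfl
    | none, some _ => rfl
    | some _, none => rfl
    | some i, some j => dist_comm (a i) (a j)
  dist_triangle
    | none, none, none => by simp
    | none, none, some _ => by simp
    | none, some i, none => by simpa using add_nonneg (hpos i).le (hpos i).le
    | none, some i, some j => by
        have := hlip j i
        rw [dist_comm] at this
        exact this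
    | some _, none, none => by simp
    | some i, none, some j => hdist i j
    | some i, some j, none => by
        have := hlip i j
        change f i ≤ dist (a i) (a j) + f j
        linarith
    | some i, some j, some k => dist_triangle (a i) (a j) (a k)
  eq_of_dist_eq_zero := by
    rintro (_ | i) (_ | j) h
    · rfl
    · exact absurd h (hpos j).ne'
    · exact absurd h (hpos i).ne'
    · exact congrArg some (ha (dist_eq_zero.1 h))

theorem IsBoundedUrysohnSpace.extensionProperty (h : IsBoundedUrysohnSpace U) :
    ExtensionProperty U := by
  intro p hp F hF
  by_cases hz : ∃ u, p u = 0
  · obtain ⟨u, hu⟩ := hz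
    refine ⟨u, fun v _ => le_antisymm ?_ ?_⟩
    · have := hp.dist_le u v
      linarith
    · have := hp.lip v u
      rw [dist_comm] at this
      linarith
  have hpos : ∀ u, 0 < p u := fun u =>
    lt_of_le_of_ne (hp.nonneg u) fun hu => hz ⟨u, hu.symm⟩
  have := hF.to_subtype
  obtain ⟨n, ⟨e⟩⟩ := Finite.exists_equiv_fin F
  let a : Fin n → U := fun i => (e.symm i).1
  have ha : Function.Injective a := Subtype.val_injective.comp e.symm.injective
  let M := onePointExtension a ha (fun i => p (a i)) (fun i => hpos _) (fun i j => hp.lip _ _)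
    (fun i j => hp.dist_le _ _)
  have hsome : ∀ i j, dist (some i : Option (Fin n)) (some j) = dist (a i) (a j) :=
    fun _ _ => rfl
  have hnone : ∀ i, dist (none : Option (Fin n)) (some i) = p (a i) := fun _ => rfl
  obtain ⟨φ, hφ⟩ := h.embeds_finite (Option (Fin n)) (Metric.diam_le_of_forall_dist_le zero_le_one
    (by
      rintro (_ | i) - (_ | j) -
      · rw [dist_self]
        exact zero_le_one
      · rw [hnone]
        exact hp.le_one _
      · rw [dist_comm, hnone]
        exact hp.le_one _
      · rw [hsome]
        exact h.dist_le_one _ _))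
  obtain ⟨g, hg⟩ := h.homogeneous.exists_isometryEquiv (fun i => φ (some i)) a
    (fun i j => by rw [hφ.dist_eq, hsome])
  refine ⟨g (φ none), fun u hu => ?_⟩
  have hau : a (e ⟨u, hu⟩) = u := by simp [a]
  have h1 : dist (g (φ none)) (g (φ (some (e ⟨u, hu⟩)))) = p (a (e ⟨u, hu⟩)) := by
    rw [g.dist_eq, hφ.dist_eq, hnone]
  rwa [hg, hau] at h1

/-- A complete separable space of diameter at most `1` with the extension property is a bounded
Urysohn space. -/
theorem isBoundedUrysohnSpace_of_extensionProperty [CompleteSpace U]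
    [TopologicalSpace.SeparableSpace U] [Nonempty U] (hU : ∀ x y : U, dist x y ≤ 1)
    (hE : ExtensionProperty U) : IsBoundedUrysohnSpace U where
  complete := inferInstance
  separable := inferInstance
  diam_eq_one := by
    refine le_antisymm (Metric.diam_le_of_forall_dist_le zero_le_one fun x _ y _ => hU x y) ?_
    obtain ⟨x₀⟩ := ‹Nonempty U›
    obtain ⟨x, hx⟩ := hE (fun _ => 1) ⟨fun _ => le_rfl, fun u v => by simp,
      fun u v => (hU u v).trans one_le_two |>.trans_eq one_add_one_eq_two.symm⟩ {x₀}
      (Set.finite_singleton _)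
    rw [← hx x₀ rfl]
    refine Metric.dist_le_diam_of_mem ?_ (Set.mem_univ _) (Set.mem_univ _)
    exact Metric.isBounded_iff.2 ⟨1, fun x _ y _ => hU x y⟩
  homogeneous := hE.isUltrahomogeneousMetric hU
  embeds_finite := by
    intro F _ _ hF
    have hF1 : ∀ a b : F, dist a b ≤ 1 := fun a b =>
      (Metric.dist_le_diam_of_mem (Set.toFinite _).isBounded (Set.mem_univ a)
        (Set.mem_univ b)).trans hF
    suffices h : ∀ S : Set F, S.Finite →
        ∃ f : F → U, ∀ a ∈ S, ∀ b ∈ S, dist (f a) (f b) = dist a b by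
      obtain ⟨f, hf⟩ := h Set.univ Set.finite_univ
      exact ⟨f, Isometry.of_dist_eq fun a b => hf a (Set.mem_univ _) b (Set.mem_univ _)⟩
    intro S hS
    induction S, hS using Set.Finite.induction_on with
    | empty => exact ⟨fun _ => Classical.arbitrary U, by simp⟩
    | @insert c S hc hS ih =>
      obtain ⟨f, hf⟩ := ih
      have := hS.to_subtype
      have hK : IsKatetov (freeExt (fun x : S => f x.1) (fun x : S => dist c x.1)) :=
        isKatetov_freeExt hU fun x y => by
          rw [hf _ x.2 _ y.2]
          exact dist_triangle_left _ _ _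
      obtain ⟨x, hx⟩ := hE _ hK (f '' S) (hS.image f)
      have hxb : ∀ b ∈ S, dist x (f b) = dist c b := fun b hb => by
        rw [hx _ ⟨b, hb, rfl⟩]
        refine le_antisymm ?_ (le_freeExt (hF1 _ _) fun y => ?_)
        · exact freeExt_le_weight (a := fun x : S => f x.1) (w := fun x : S => dist c x.1) ⟨b, hb⟩
        · rw [hf _ y.2 _ hb]
          exact dist_triangle _ _ _
      classical
      have hup : ∀ b ∈ S, Function.update f c x b = f b := fun b hb =>
        Function.update_of_ne (fun h : b = c => hc (h ▸ hb)) _ _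
      refine ⟨Function.update f c x, ?_⟩
      rintro a (rfl | ha) b (rfl | hb)
      · simp
      · rw [Function.update_self, hup b hb, hxb b hb]
      · rw [Function.update_self, hup a ha, dist_comm, hxb a ha, dist_comm]
      · rw [hup a ha, hup b hb, hf a ha b hb]

end Urysohn

/-! ### Existence of the bounded Urysohn space -/

/-- In a complete space approximate realizations of Katětov functions suffice for the extension
property: an approximate realization `x` with error at most `η` can be improved to one with error
at most `η / 2` at distance at most `2 * η` from `x`. -/
theorem extensionProperty_of_approx {U : Type*} [MetricSpace U] [CompleteSpace U]
    (hU : ∀ x y : U, dist x y ≤ 1)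
    (h : ∀ p : U → ℝ, IsKatetov p → ∀ F : Set U, F.Finite → ∀ ε > 0,
      ∃ x, ∀ u ∈ F, |dist x u - p u| ≤ ε) : ExtensionProperty U := by
  intro p hp F hF
  have := hF.to_subtype
  have step : ∀ (η : ℝ) (x : U), ∃ y, 0 < η → (∀ u ∈ F, |dist x u - p u| ≤ η) →
      (∀ u ∈ F, |dist y u - p u| ≤ η / 2) ∧ dist x y ≤ 2 * η := by
    intro η x
    by_cases hη : 0 < η
    swap
    · exact ⟨x, fun h => absurd h hη⟩
    by_cases hx : ∀ u ∈ F, |dist x u - p u| ≤ η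
    swap
    · exact ⟨x, fun _ h => absurd h hx⟩
    let a : Option F → U := fun o => o.elim x Subtype.val
    let w : Option F → ℝ := fun o => o.elim η fun u => p u
    have hux : ∀ u ∈ F, dist x u ≤ p u + η ∧ p u ≤ η + dist x u := fun u hu => by
      have := abs_le.1 (hx u hu)
      constructor <;> linarith
    have hK : IsKatetov (freeExt a w) := by
      refine isKatetov_freeExt hU ?_
      rintro (_ | u) (_ | v)
      · change dist x x ≤ η + η
        rw [dist_self]
        linarith
      · change dist x v ≤ η + p v
        linarith [(hux v v.2).1]
      · change dist (u : U) x ≤ p u + η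
        rw [dist_comm]
        exact (hux u u.2).1
      · exact hp.dist_le _ _
    obtain ⟨y, hy⟩ := h _ hK (insert x F) (hF.insert x) (η / 2) (half_pos hη)
    refine ⟨y, fun _ _ => ⟨fun u hu => ?_, ?_⟩⟩
    · have he : freeExt a w u = p u := by
        refine le_antisymm (freeExt_le_weight (a := a) (w := w) (some ⟨u, hu⟩))
          (le_freeExt (hp.le_one u) ?_)
        rintro (_ | v)
        · exact (hux u hu).2
        · change p u ≤ p v + dist (v : U) u
          rw [dist_comm]
          exact hp.lip _ _
      rw [← he]
      exact hy u (Set.mem_insert_of_mem _ hu)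
    · have h1 := (abs_le.1 (hy x (Set.mem_insert _ _))).2
      have h2 : freeExt a w x ≤ η := freeExt_le_weight (a := a) (w := w) none
      rw [dist_comm]
      linarith
  choose nxt hn using step
  obtain ⟨x₀, hx₀⟩ := h p hp F hF 1 one_pos
  let s : ℕ → U := fun n => Nat.rec x₀ (fun n x => nxt ((1 / 2) ^ n) x) n
  have hs : ∀ n, ∀ u ∈ F, |dist (s n) u - p u| ≤ (1 / 2 : ℝ) ^ n := by
    intro n
    induction n with
    | zero =>
      intro u hu
      rw [pow_zero]
      exact hx₀ u hu
    | succ n ih =>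
      intro u hu
      have := (hn _ _ (by positivity) ih).1 u hu
      exact this.trans_eq (by ring)
  have hc : CauchySeq s := cauchySeq_of_le_geometric (1 / 2) 2 (by norm_num)
    fun n => (hn _ _ (by positivity) (hs n)).2
  obtain ⟨x, hx⟩ := cauchySeq_tendsto_of_complete hc
  refine ⟨x, fun u hu => ?_⟩
  have h1 : Filter.Tendsto (fun n => |dist (s n) u - p u|) Filter.atTop
      (nhds |dist x u - p u|) := ((hx.dist tendsto_const_nhds).sub_const _).abs
  have h2 : Filter.Tendsto (fun n : ℕ => (1 / 2 : ℝ) ^ n) Filter.atTop (nhds 0) :=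
    tendsto_pow_atTop_nhds_zero_of_lt_one (by norm_num) (by norm_num)
  have h3 := le_of_tendsto_of_tendsto' h1 h2 fun n => hs n u hu
  have := abs_nonpos_iff.1 h3
  linarith

/-- The axioms of a pseudometric bounded by `1`, for a bare function on `ℕ`. -/
structure IsPseudoDist (d : ℕ → ℕ → ℝ) : Prop where
  self : ∀ i, d i i = 0
  comm : ∀ i j, d i j = d j i
  tri : ∀ i j k, d i k ≤ d i j + d j k
  le_one : ∀ i j, d i j ≤ 1

theorem IsPseudoDist.nonneg {d : ℕ → ℕ → ℝ} (hd : IsPseudoDist d) (i j : ℕ) : 0 ≤ d i j := by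
  have := hd.tri i j i
  rw [hd.self, hd.comm j i] at this
  linarith

/-- `d` with the distances from the point `n` to the other points replaced by `r`. -/
def replaceRow (d : ℕ → ℕ → ℝ) (n : ℕ) (r : ℕ → ℝ) (i j : ℕ) : ℝ :=
  if i = j then 0 else if i = n then r j else if j = n then r i else d i j

theorem IsPseudoDist.replaceRow {d : ℕ → ℕ → ℝ} (hd : IsPseudoDist d) (n : ℕ) {r : ℕ → ℝ}
    (h1 : ∀ i, r i ≤ 1) (h2 : ∀ i j, r i ≤ r j + d i j) (h3 : ∀ i j, d i j ≤ r i + r j) :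
    IsPseudoDist (replaceRow d n r) := by
  have h0 : ∀ i, 0 ≤ r i := fun i => by
    have := h3 i i
    rw [hd.self] at this
    linarith
  have hn := hd.nonneg
  refine ⟨fun i => by simp [_root_.replaceRow], fun i j => ?_, fun i j k => ?_, fun i j => ?_⟩
  · unfold _root_.replaceRow
    split_ifs <;> first | rfl | (exfalso; omega) | exact hd.comm i j
  · have e1 := h2 i j
    have e2 := h2 k j
    have e3 := h3 i k
    have e4 := hd.tri i j k
    have e5 := hd.comm j k
    have e6 := h2 j k
    have e7 := h2 i k
    have e8 := hd.comm i j
    have e9 := h2 j i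
    have := h0 i
    have := h0 j
    have := h0 k
    have := hn i j
    have := hn j k
    have := hn i k
    unfold _root_.replaceRow
    split_ifs <;> subst_vars <;>
      first
      | (exfalso; omega)
      | linarith
  · unfold _root_.replaceRow
    split_ifs
    · exact zero_le_one
    · exact h1 _
    · exact h1 _
    · exact hd.le_one _ _

/-- A pseudometric on `ℕ` that realizes every rational one-point extension problem: a finite list
of pairs `(i, q)` asks for a point at distance at most `q` from `i`, and is solvable as soon as
`d i j ≤ q + q'` for all pairs `(i, q)`, `(j, q')`. The point `n` is made to solve the `n`-th
problem, each problem being repeated infinitely often. -/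
theorem exists_isPseudoDist : ∃ d : ℕ → ℕ → ℝ, IsPseudoDist d ∧
    ∀ l : List (ℕ × ℚ), (∀ x ∈ l, ∀ y ∈ l, d x.1 y.1 ≤ x.2 + y.2) →
      ∃ n, ∀ x ∈ l, d n x.1 ≤ x.2 ∧ (d n x.1 = 1 ∨ ∃ y ∈ l, d n x.1 = y.2 + d y.1 x.1) := by
  classical
  let task : ℕ → List (ℕ × ℚ) := fun n => (Encodable.decode (Nat.unpair n).1).getD []
  let row : (ℕ → ℕ → ℝ) → ℕ → ℕ → ℝ := fun d n i =>
    cappedInf fun x : {x // x ∈ task n} => (x.1.2 : ℝ) + d x.1.1 i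
  let ok : (ℕ → ℕ → ℝ) → ℕ → Prop := fun d n =>
    ∀ x ∈ task n, ∀ y ∈ task n, d x.1 y.1 ≤ (x.2 : ℝ) + y.2
  have hok : ∀ d n, IsPseudoDist d → ok d n → IsPseudoDist (replaceRow d n (row d n)) := by
    intro d n hd h
    have hnn : ∀ i, 0 ≤ row d n i := fun i => le_cappedInf zero_le_one fun x => by
      have := h x.1 x.2 x.1 x.2
      rw [hd.self] at this
      linarith [hd.nonneg x.1.1 i]
    refine hd.replaceRow n (fun i => cappedInf_le_one _) (fun i j => ?_) fun i j => ?_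
    · rcases cappedInf_cases (fun x : {x // x ∈ task n} => (x.1.2 : ℝ) + d x.1.1 j) with
        hj | ⟨x, hj⟩
      · have : row d n i ≤ 1 := cappedInf_le_one _
        change row d n j = 1 at hj
        linarith [hd.nonneg i j]
      · have : row d n i ≤ (x.1.2 : ℝ) + d x.1.1 i := cappedInf_le _ x
        change row d n j = _ at hj
        linarith [hd.tri x.1.1 j i, hd.comm i j]
    · rcases cappedInf_cases (fun x : {x // x ∈ task n} => (x.1.2 : ℝ) + d x.1.1 j) with
        hj | ⟨x, hj⟩
      · change row d n j = 1 at hj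
        linarith [hd.le_one i j, hnn i]
      rcases cappedInf_cases (fun x : {x // x ∈ task n} => (x.1.2 : ℝ) + d x.1.1 i) with
        hi | ⟨y, hi⟩
      · change row d n i = 1 at hi
        linarith [hd.le_one i j, hnn j]
      change row d n j = _ at hj
      change row d n i = _ at hi
      linarith [h x.1 x.2 y.1 y.2, hd.tri i y.1.1 j, hd.tri y.1.1 x.1.1 j, hd.comm i y.1.1,
        hd.comm x.1.1 y.1.1]
  let D : ℕ → {d // IsPseudoDist d} := fun n => Nat.rec
    ⟨fun _ _ => 0, fun _ => rfl, fun _ _ => rfl, fun _ _ _ => by simp, fun _ _ => zero_le_one⟩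
    (fun n d => if h : ok d.1 n then ⟨_, hok d.1 n d.2 h⟩ else d) n
  have hD : ∀ n, ok (D n).1 n → (D (n + 1)).1 = replaceRow (D n).1 n (row (D n).1 n) := by
    intro n h
    change (if h : ok (D n).1 n then
      (⟨_, hok _ n (D n).2 h⟩ : {d // IsPseudoDist d}) else D n).1 = _
    rw [dif_pos h]
  have hD' : ∀ n, ¬ ok (D n).1 n → (D (n + 1)).1 = (D n).1 := by
    intro n h
    change (if h : ok (D n).1 n then
      (⟨_, hok _ n (D n).2 h⟩ : {d // IsPseudoDist d}) else D n).1 = _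
    rw [dif_neg h]
  have stab1 : ∀ n i j, i < n → j < n → (D (n + 1)).1 i j = (D n).1 i j := by
    intro n i j hi hj
    by_cases h : ok (D n).1 n
    · rw [hD n h]
      unfold replaceRow
      split_ifs with h1
      · subst h1
        exact ((D n).2.self i).symm
      · omega
      · omega
      · rfl
    · rw [hD' n h]
  have stab : ∀ n m i j, i < n → j < n → n ≤ m → (D m).1 i j = (D n).1 i j := by
    intro n m i j hi hj hnm
    induction m, hnm using Nat.le_induction with
    | base => rfl
    | succ m hm ih => rw [stab1 m i j (by omega) (by omega), ih]
  let d : ℕ → ℕ → ℝ := fun i j => (D (max i j + 1)).1 i j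
  have hd : ∀ n i j, i < n → j < n → d i j = (D n).1 i j := by
    intro n i j hi hj
    exact (stab (max i j + 1) n i j (by omega) (by omega) (by omega)).symm
  have hdP : IsPseudoDist d := by
    refine ⟨fun i => (D (max i i + 1)).2.self i, fun i j => ?_, fun i j k => ?_,
      fun i j => (D (max i j + 1)).2.le_one _ _⟩
    · rw [hd (max i j + 1) i j (by omega) (by omega), hd (max i j + 1) j i (by omega) (by omega)]
      exact (D (max i j + 1)).2.comm i j
    · rw [hd (i + j + k + 1) i j (by omega) (by omega), hd (i + j + k + 1) j k (by omega) (by omega),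
        hd (i + j + k + 1) i k (by omega) (by omega)]
      exact (D (i + j + k + 1)).2.tri i j k
  refine ⟨d, hdP, fun l hl => ?_⟩
  -- `b` bounds all indices in `l`, and `n ≥ b` is an index with `task n = l`
  obtain ⟨b, hb⟩ : ∃ b, ∀ x ∈ l, x.1 < b := by
    obtain ⟨b, hb⟩ := (l.toFinset.image Prod.fst).bddAbove
    exact ⟨b + 1, fun x hx => Nat.lt_succ_of_le (hb (by
      simp only [Finset.coe_image, Set.mem_image]
      exact ⟨x, by simpa using hx, rfl⟩))⟩
  let n := Nat.pair (Encodable.encode l) b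
  have hbn : b ≤ n := Nat.right_le_pair _ _
  have htask : task n = l := by simp [task, n]
  have hlt : ∀ x ∈ l, x.1 < n := fun x hx => (hb x hx).trans_le hbn
  have hokn : ok (D n).1 n := by
    intro x hx y hy
    rw [htask] at hx hy
    rw [← hd n _ _ (hlt x hx) (hlt y hy)]
    exact hl x hx y hy
  have hval : ∀ x ∈ l, d n x.1 = row (D n).1 n x.1 := by
    intro x hx
    have := hlt x hx
    rw [hd (n + 1) n x.1 (by omega) (by omega), hD n hokn]
    unfold replaceRow
    rw [if_neg (by omega), if_pos rfl]
  refine ⟨n, fun x hx => ⟨?_, ?_⟩⟩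
  · rw [hval x hx]
    refine (cappedInf_le _ (⟨x, htask ▸ hx⟩ : {x // x ∈ task n})).trans ?_
    rw [(D n).2.self, add_zero]
  · rw [hval x hx]
    rcases cappedInf_cases (fun y : {y // y ∈ task n} => (y.1.2 : ℝ) + (D n).1 y.1.1 x.1) with
      h | ⟨y, h⟩
    · exact Or.inl h
    · have hy : y.1 ∈ l := htask ▸ y.2
      refine Or.inr ⟨y.1, hy, h.trans ?_⟩
      rw [hd n _ _ (hlt _ hy) (hlt _ hx)]

/-- The completion of a countable pseudometric space that solves all rational one-point extension
problems has the extension property. -/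
theorem extensionProperty_completion {X : Type*} [PseudoMetricSpace X]
    (hX : ∀ x y : X, dist x y ≤ 1)
    (h : ∀ l : List (X × ℚ), (∀ x ∈ l, ∀ y ∈ l, dist x.1 y.1 ≤ x.2 + y.2) →
      ∃ n, ∀ x ∈ l, dist n x.1 ≤ x.2 ∧
        (dist n x.1 = 1 ∨ ∃ y ∈ l, dist n x.1 = y.2 + dist y.1 x.1)) :
    (∀ x y : UniformSpace.Completion X, dist x y ≤ 1) ∧
      ExtensionProperty (UniformSpace.Completion X) := by
  have hU : ∀ x y : UniformSpace.Completion X, dist x y ≤ 1 := fun x y => by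
    refine UniformSpace.Completion.induction_on₂ x y ?_ fun a b => ?_
    · exact isClosed_le (continuous_fst.dist continuous_snd) continuous_const
    · rw [UniformSpace.Completion.dist_eq]
      exact hX a b
  refine ⟨hU, extensionProperty_of_approx hU fun p hp F hF ε hε => ?_⟩
  obtain ⟨η, hη, rfl⟩ : ∃ η > 0, ε = 3 * η := ⟨ε / 3, by positivity, by ring⟩
  have h1 : ∀ u : UniformSpace.Completion X, ∃ i : X, dist u i < η := fun u => by
    obtain ⟨_, ⟨i, rfl⟩, hi⟩ := Metric.mem_closure_iff.1
      (UniformSpace.Completion.denseRange_coe (α := X) u) η hη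
    exact ⟨i, hi⟩
  choose i hi using h1
  have h2 : ∀ u : UniformSpace.Completion X, ∃ q : ℚ, p u + η < q ∧ (q : ℝ) < p u + 2 * η :=
    fun u => exists_rat_btwn (by linarith)
  choose q hq1 hq2 using h2
  have hclose : ∀ u v, dist (i u) (i v) ≤ dist u v + 2 * η ∧ dist u v ≤ dist (i u) (i v) + 2 * η := by
    intro u v
    rw [← UniformSpace.Completion.dist_eq (i u) (i v)]
    have e1 := dist_triangle4 (i u : UniformSpace.Completion X) u v (i v)
    have e2 := dist_triangle4 u (i u : UniformSpace.Completion X) (i v) v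
    rw [dist_comm (i u : UniformSpace.Completion X) u] at e1
    rw [dist_comm (i v : UniformSpace.Completion X) v] at e2
    constructor <;> linarith [hi u, hi v]
  obtain ⟨n, hn⟩ := h (hF.toFinset.toList.map fun u => (i u, q u)) (by
    simp only [List.mem_map]
    rintro _ ⟨u, -, rfl⟩ _ ⟨v, -, rfl⟩
    have := hp.dist_le u v
    linarith [hq1 u, hq1 v, (hclose u v).1])
  refine ⟨n, fun u hu => ?_⟩
  have hmem : (i u, q u) ∈ hF.toFinset.toList.map fun u => (i u, q u) :=
    List.mem_map.2 ⟨u, by simpa using hu, rfl⟩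
  obtain ⟨hn1, hn2⟩ := hn _ hmem
  have h3 : p u - η ≤ dist n (i u) := by
    rcases hn2 with h | ⟨y, hy, h⟩
    · rw [h]
      linarith [hp.le_one u]
    · obtain ⟨v, -, rfl⟩ := List.mem_map.1 hy
      have := hp.lip u v
      simp only at h
      linarith [hq1 v, (hclose v u).2, dist_comm u v]
  have h4 : |dist (n : UniformSpace.Completion X) u - dist n (i u)| ≤ η := by
    rw [← UniformSpace.Completion.dist_eq n (i u)]
    have e1 := dist_triangle (n : UniformSpace.Completion X) u (i u)
    have e2 := dist_triangle (n : UniformSpace.Completion X) (i u) u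
    rw [dist_comm (i u : UniformSpace.Completion X) u] at e2
    rw [abs_le]
    constructor <;> linarith [hi u]
  simp only at hn1
  rw [abs_le] at h4 ⊢
  constructor <;> linarith [hq2 u, h4.1, h4.2]

theorem exists_isBoundedUrysohnSpace :
    ∃ (U : Type) (_ : MetricSpace U), IsBoundedUrysohnSpace U := by
  obtain ⟨d, hd, hl⟩ := exists_isPseudoDist
  suffices H : ∀ (X : Type) [Countable X] [Nonempty X] [PseudoMetricSpace X],
      (∀ x y : X, dist x y ≤ 1) →
      (∀ l : List (X × ℚ), (∀ x ∈ l, ∀ y ∈ l, dist x.1 y.1 ≤ x.2 + y.2) →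
        ∃ n, ∀ x ∈ l, dist n x.1 ≤ x.2 ∧
          (dist n x.1 = 1 ∨ ∃ y ∈ l, dist n x.1 = y.2 + dist y.1 x.1)) →
      ∃ (U : Type) (_ : MetricSpace U), IsBoundedUrysohnSpace U from
    @H ℕ _ _ { dist := d, dist_self := hd.self, dist_comm := hd.comm, dist_triangle := hd.tri }
      hd.le_one hl
  intro X _ _ _ hX h
  obtain ⟨hU, hE⟩ := extensionProperty_completion hX h
  have : Nonempty (UniformSpace.Completion X) := ⟨((Classical.arbitrary X : X) : _)⟩
  exact ⟨UniformSpace.Completion X, inferInstance, isBoundedUrysohnSpace_of_extensionProperty hU hE⟩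

/-! ### Realizing types by points that are moved far -/

section Displacement

variable {U : Type*} [MetricSpace U]

/-- Near a point moved by `4 * s` there are points moved by at least `s` that avoid the
`s`-neighbourhood of a given finite set. -/
theorem exists_displaced_far (hU : ∀ x y : U, dist x y ≤ 1) (hE : ExtensionProperty U)
    (g : U ≃ᵢ U) {s : ℝ} {a₀ : U} (hs : 0 < s) (ha₀ : dist a₀ (g a₀) = 4 * s) {F : Set U}
    (hF : F.Finite) : ∃ e, s ≤ dist e (g e) ∧ ∀ x ∈ F, s ≤ dist e x := by
  have hs1 : 4 * s ≤ 1 := ha₀ ▸ hU _ _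
  obtain ⟨e, he⟩ := hE _ (isKatetov_freeExt (a := fun _ : Unit => a₀) (w := fun _ => s) hU
    fun _ _ => by rw [dist_self]; linarith) (insert a₀ F) (hF.insert _)
  have h1 : dist e a₀ ≤ s := by
    rw [he a₀ (Set.mem_insert _ _)]
    exact freeExt_le_weight (a := fun _ : Unit => a₀) (w := fun _ => s) ()
  refine ⟨e, ?_, fun x hx => ?_⟩
  · have := dist_triangle4 a₀ e (g e) (g a₀)
    rw [g.dist_eq, dist_comm a₀ e] at this
    linarith
  · rw [he x (Set.mem_insert_of_mem _ hx)]
    exact le_freeExt (by linarith) fun _ => by linarith [dist_nonneg (x := a₀) (y := x)]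

theorem exists_displaced_dist_eq_one (hU : ∀ x y : U, dist x y ≤ 1) (hE : ExtensionProperty U)
    (g : U ≃ᵢ U) {s : ℝ} {a₀ : U} (hs : 0 < s) (ha₀ : dist a₀ (g a₀) = 4 * s) {F : Set U}
    (hF : F.Finite) : ∃ e, s ≤ dist e (g e) ∧ ∀ x ∈ F, dist e x = 1 := by
  have hs1 : 4 * s ≤ 1 := ha₀ ▸ hU _ _
  obtain ⟨c, hc1, hc2⟩ := exists_displaced_far hU hE g hs ha₀ (hF.image g.symm)
  obtain ⟨e, he⟩ := hE _ (isKatetov_freeExt (a := fun _ : Unit => g c) (w := fun _ => 1 - s) hU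
    fun _ _ => by rw [dist_self]; linarith) (insert c (insert (g c) F)) ((hF.insert _).insert _)
  have h1 : dist e (g c) ≤ 1 - s := by
    rw [he (g c) (by simp)]
    exact freeExt_le_weight (a := fun _ : Unit => g c) (w := fun _ => 1 - s) ()
  have h2 : 1 ≤ dist e c := by
    rw [he c (by simp)]
    exact le_freeExt le_rfl fun _ => by linarith [dist_comm c (g c)]
  refine ⟨e, ?_, fun x hx => ?_⟩
  · have := dist_triangle_left (g e) (g c) e
    have := dist_triangle (g c) e (g e)
    rw [dist_comm (g c) (e), dist_comm (g c), g.dist_eq] at this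
    linarith
  · rw [he x (by simp [hx])]
    refine le_antisymm (freeExt_le_one _) (le_freeExt le_rfl fun _ => ?_)
    have := hc2 _ ⟨x, hx, rfl⟩
    rw [← g.dist_eq, g.apply_symm_apply] at this
    linarith

/-- A type all of whose values are at least `1 / 2` is realized by a point moved by at least `s`:
it is compatible with the distances `1` and `1 - s` to a far point `e` and its image `g e`. -/
theorem exists_displaced_of_half_le (hU : ∀ x y : U, dist x y ≤ 1) (hE : ExtensionProperty U)
    (g : U ≃ᵢ U) {s : ℝ} {a₀ : U} (hs : 0 < s) (ha₀ : dist a₀ (g a₀) = 4 * s) {F : Set U}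
    (hF : F.Finite) {t : U → ℝ} (ht : IsKatetov t) (ht2 : ∀ x, 1 / 2 ≤ t x) :
    ∃ y, s ≤ dist y (g y) ∧ ∀ x ∈ F, dist y x = t x := by
  have hs1 : 4 * s ≤ 1 := ha₀ ▸ hU _ _
  obtain ⟨e, he, heF⟩ := exists_displaced_dist_eq_one hU hE g hs ha₀ (hF.union (hF.image g.symm))
  have he1 : ∀ x ∈ F, dist e x = 1 := fun x hx => heF x (Or.inl hx)
  have he2 : ∀ x ∈ F, dist (g e) x = 1 := fun x hx => by
    have := heF (g.symm x) (Or.inr ⟨x, hx, rfl⟩)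
    rwa [← g.dist_eq, g.apply_symm_apply] at this
  have := hF.to_subtype
  let a : Option F → U := fun o => o.elim (g e) Subtype.val
  let w : Option F → ℝ := fun o => o.elim (1 - s) fun x => t x
  have hK : IsKatetov (freeExt a w) := by
    refine isKatetov_freeExt hU ?_
    rintro (_ | x) (_ | y)
    · change dist (g e) (g e) ≤ 1 - s + (1 - s)
      rw [dist_self]
      linarith
    · change dist (g e) y ≤ 1 - s + t y
      linarith [ht2 y, hU (g e) y]
    · change dist (x : U) (g e) ≤ t x + (1 - s)
      linarith [ht2 x, hU x (g e)]
    · exact ht.dist_le _ _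
  obtain ⟨y, hy⟩ := hE _ hK (insert e (insert (g e) F)) ((hF.insert _).insert _)
  have h1 : dist y (g e) ≤ 1 - s := by
    rw [hy _ (by simp)]
    exact freeExt_le_weight (a := a) (w := w) none
  have h2 : 1 ≤ dist y e := by
    rw [hy _ (by simp)]
    refine le_freeExt le_rfl ?_
    rintro (_ | x)
    · change 1 ≤ 1 - s + dist (g e) e
      linarith [dist_comm e (g e)]
    · change 1 ≤ t x + dist (x : U) e
      linarith [ht2 x, he1 x x.2, dist_comm e x]
  refine ⟨y, ?_, fun x hx => ?_⟩
  · have := dist_triangle (g e) y (g y)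
    rw [dist_comm (g e) y, g.dist_eq, dist_comm e] at this
    linarith
  · rw [hy x (by simp [hx])]
    refine le_antisymm (freeExt_le_weight (a := a) (w := w) (some ⟨x, hx⟩))
      (le_freeExt (ht.le_one x) ?_)
    rintro (_ | z)
    · change t x ≤ 1 - s + dist (g e) x
      linarith [he2 x hx, ht.le_one x]
    · change t x ≤ t z + dist (z : U) x
      linarith [ht.lip x z, dist_comm x z]

/-- Up to a constant `s` depending on `g` only, every type `p` over a finite set `E` is realized by
a point that `g` moves as far as the triangle inequality allows, given `p` and the action of `g`
on `E`. -/
theorem exists_displaced (hU : ∀ x y : U, dist x y ≤ 1) (hE : ExtensionProperty U)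
    (g : U ≃ᵢ U) {s : ℝ} {a₀ : U} (hs : 0 < s) (ha₀ : dist a₀ (g a₀) = 4 * s) {E : Set U}
    (hfin : E.Finite) {p : U → ℝ} (hp : IsKatetov p) {r : ℝ} (hrs : r ≤ s)
    (hr : ∀ a ∈ E, ∀ b ∈ E, r ≤ p a + p b + dist (g a) b) :
    ∃ y, r ≤ dist y (g y) ∧ ∀ x ∈ E, dist y x = p x := by
  have hs1 : 4 * s ≤ 1 := ha₀ ▸ hU _ _
  have := hfin.to_subtype
  -- `r` may be replaced by the optimal value `m`
  obtain ⟨m, hrm, hms, hm, hm'⟩ : ∃ m, r ≤ m ∧ m ≤ s ∧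
      (∀ a ∈ E, ∀ b ∈ E, m ≤ p a + p b + dist (g a) b) ∧
      (m = s ∨ ∃ a ∈ E, ∃ b ∈ E, m = p a + p b + dist (g a) b) := by
    let c : Option (E × E) → ℝ := fun o => o.elim s fun x => p x.1 + p x.2 + dist (g x.1) x.2
    have hb : BddBelow (Set.range c) := (Set.finite_range c).bddBelow
    refine ⟨⨅ o, c o, le_ciInf ?_, ciInf_le hb none,
      fun a ha b hb' => ciInf_le hb (some (⟨a, ha⟩, ⟨b, hb'⟩)), ?_⟩
    · rintro (_ | ⟨a, b⟩)
      · exact hrs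
      · exact hr a a.2 b b.2
    · obtain ⟨_ | ⟨a, b⟩, ho⟩ := exists_eq_ciInf_of_finite (f := c)
      · exact Or.inl ho.symm
      · exact Or.inr ⟨a, a.2, b, b.2, ho.symm⟩
  suffices h : ∃ y, m ≤ dist y (g y) ∧ ∀ x ∈ E, dist y x = p x by
    obtain ⟨y, hy, hy'⟩ := h
    exact ⟨y, hrm.trans hy, hy'⟩
  have hm0 : 0 ≤ m := by
    rcases hm' with h | ⟨a, -, b, -, h⟩
    · linarith
    · linarith [hp.nonneg a, hp.nonneg b, dist_nonneg (x := g a) (y := b)]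
  -- the point `g e` is at distance `t` from all points of `E` and of `g E`
  let t : U → ℝ := freeExt (fun b : E => (b : U)) (fun b : E => 1 - s + p b)
  have ht : IsKatetov t := isKatetov_freeExt hU fun x y => by
    linarith [hp.nonneg x, hp.nonneg y, hU x y]
  have htle : ∀ b ∈ E, ∀ x, t x ≤ 1 - s + p b + dist b x := fun b hb x =>
    freeExt_le (a := fun b : E => (b : U)) (w := fun b : E => 1 - s + p b) ⟨b, hb⟩ x
  have ht1 : ∀ x, 1 - s ≤ t x := fun x => le_freeExt (by linarith) fun b => by
    linarith [hp.nonneg b, dist_nonneg (x := (b : U)) (y := x)]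
  obtain ⟨e, he, heE⟩ := exists_displaced_of_half_le hU hE g hs ha₀
    (hfin.union (hfin.image g.symm)) (t := fun x => t (g x))
    ⟨fun u => ht.le_one _, fun u v => by rw [← g.dist_eq]; exact ht.lip _ _,
      fun u v => by rw [← g.dist_eq]; exact ht.dist_le _ _⟩ (fun x => by linarith [ht1 (g x)])
  have he1 : ∀ x ∈ E, dist e x = t (g x) := fun x hx => heE x (Or.inl hx)
  have he2 : ∀ x ∈ E, dist (g e) x = t x := fun x hx => by
    have := heE (g.symm x) (Or.inr ⟨x, hx, rfl⟩)
    rwa [← g.dist_eq, g.apply_symm_apply] at this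
  let a : E ⊕ Bool → U := Sum.elim Subtype.val fun b => if b then e else g e
  let w : E ⊕ Bool → ℝ := Sum.elim (fun x => p x) fun b => if b then 1 - s + m else 1 - s
  have hae : ∀ x ∈ E, dist x e ≤ p x + (1 - s + m) := fun x hx => by
    rw [dist_comm, he1 x hx]
    rcases hm' with h | ⟨a', ha', b', hb', h⟩
    · linarith [ht.le_one (g x), hp.nonneg x]
    · have h1 := htle b' hb' (g x)
      have h2 := dist_triangle b' (g a') (g x)
      rw [g.dist_eq] at h2
      linarith [hp.dist_le a' x, dist_comm b' (g a')]
  have hae' : ∀ x ∈ E, dist x (g e) ≤ p x + (1 - s) := fun x hx => by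
    rw [dist_comm, he2 x hx]
    have := htle x hx x
    rw [dist_self] at this
    linarith
  have hee : dist e (g e) ≤ 1 := hU _ _
  have hK : IsKatetov (freeExt a w) := by
    refine isKatetov_freeExt hU ?_
    rintro (x | _ | _) (y | _ | _) <;>
      simp only [a, w, Sum.elim_inl, Sum.elim_inr, if_true, Bool.false_eq_true, if_false, dist_self]
    · exact hp.dist_le _ _
    · exact hae' x x.2
    · exact hae x x.2
    · linarith [hae' y y.2, dist_comm (g e) y]
    · linarith
    · linarith [dist_comm (g e) e]
    · linarith [hae y y.2, dist_comm e y]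
    · linarith
    · linarith
  obtain ⟨y, hy⟩ := hE _ hK (insert e (insert (g e) E)) ((hfin.insert _).insert _)
  have h1 : dist y (g e) ≤ 1 - s := by
    rw [hy _ (by simp)]
    exact freeExt_le_weight (a := a) (w := w) (Sum.inr false)
  have h2 : 1 - s + m ≤ dist y e := by
    rw [hy _ (by simp)]
    refine le_freeExt (by linarith) ?_
    rintro (x | _ | _) <;>
      simp only [a, w, Sum.elim_inl, Sum.elim_inr, if_true, Bool.false_eq_true, if_false, dist_self]
    · rw [dist_comm, he1 x x.2]
      rcases freeExt_cases (fun b : E => (b : U)) (fun b : E => 1 - s + p b) (g x) with h | ⟨b, h⟩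
      · change t (g x) = 1 at h
        linarith [hp.nonneg x]
      · change t (g x) = _ at h
        linarith [hm x x.2 b b.2, dist_comm (g x) b]
    · linarith [dist_comm e (g e)]
    · linarith
  refine ⟨y, ?_, fun x hx => ?_⟩
  · have := dist_triangle (g e) y (g y)
    rw [dist_comm (g e) y, g.dist_eq, dist_comm e] at this
    linarith
  · rw [hy x (by simp [hx])]
    refine le_antisymm (freeExt_le_weight (a := a) (w := w) (Sum.inl ⟨x, hx⟩))
      (le_freeExt (hp.le_one x) ?_)
    rintro (z | _ | _) <;>
      simp only [a, w, Sum.elim_inl, Sum.elim_inr, if_true, Bool.false_eq_true, if_false]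
    · linarith [hp.lip x z, dist_comm x z]
    · linarith [he2 x hx, ht1 x, hp.le_one x]
    · linarith [he1 x hx, ht1 (g x), hp.le_one x]

/-! ### Commutators with large displacement -/

/-- Back-and-forth construction of an `h` whose commutator with `g` moves every point by at least
`κ`. The finite relations `R` used satisfy `κ ≤ dist (g b) c + dist (g b') c'` for all `(b, b')`
and `(c, c')` in `R`; for the graph of `h` this says that `dist (g (h b)) (h (g b)) ≥ κ`. -/
theorem exists_displaced_commutator [CompleteSpace U] [TopologicalSpace.SeparableSpace U]
    [Nonempty U] (hU : ∀ x y : U, dist x y ≤ 1) (g : U ≃ᵢ U) {κ : ℝ}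
    (hκ : κ ≤ 1)
    (H : ∀ (w : U) (p : U → ℝ) (E : Set U), IsKatetov p → E.Finite →
      (∀ a ∈ E, ∀ b ∈ E, κ ≤ dist w (g w) + (p a + p b + dist (g a) b)) →
      ∃ v, κ ≤ dist w (g w) + dist v (g v) ∧ ∀ x ∈ E, dist v x = p x) :
    ∃ h : U ≃ᵢ U, ∀ x, κ ≤ dist (g (h x)) (h (g x)) := by
  let P : Set (U × U) → Prop := fun R => R.Finite ∧ IsometricRel R ∧
    ∀ b ∈ R, ∀ c ∈ R, κ ≤ dist (g b.1) c.1 + dist (g b.2) c.2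
  have forth : ∀ R, P R → ∀ w, ∃ v, P (insert (w, v) R) := by
    rintro R ⟨hfin, hR, hκR⟩ w
    have hK := isKatetov_transport hU hfin hR w
    let E : Set U := Prod.snd '' R ∪ ((fun x => g x.2) '' R ∪ (fun x => g.symm x.2) '' R)
    obtain ⟨v, hv, hvE⟩ := H w (transport R w) E hK
      ((hfin.image _).union ((hfin.image _).union (hfin.image _))) (by
        intro a _ b _
        have h0 := hK.nonneg
        rcases transport_cases hfin w a with ha | ⟨x, hx, ha⟩
        · linarith [h0 b, dist_nonneg (x := w) (y := g w), dist_nonneg (x := g a) (y := b)]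
        rcases transport_cases hfin w b with hb | ⟨y, hy, hb⟩
        · linarith [h0 a, dist_nonneg (x := w) (y := g w), dist_nonneg (x := g a) (y := b)]
        rw [ha, hb]
        have e1 := hκR x hx y hy
        have e2 := dist_triangle4 (g x.1) (g w) w y.1
        have e3 := dist_triangle4 (g x.2) (g a) b y.2
        rw [g.dist_eq] at e2 e3
        linarith [dist_comm x.1 w, dist_comm (g w) w, dist_comm b y.2])
    have hv1 : ∀ x ∈ R, dist v x.2 = dist w x.1 := fun x hx => by
      rw [hvE _ (Or.inl ⟨x, hx, rfl⟩), transport_eq hU hfin hR w hx]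
    have hA : ∀ c ∈ R, κ ≤ dist (g w) c.1 + dist (g v) c.2 := by
      intro c hc
      have e0 : dist (g v) c.2 = dist v (g.symm c.2) := by
        rw [← g.dist_eq v, g.apply_symm_apply]
      rw [e0, hvE _ (Or.inr (Or.inr ⟨c, hc, rfl⟩))]
      rcases transport_cases hfin w (g.symm c.2) with h | ⟨a, ha, h⟩
      · rw [h]
        linarith [dist_nonneg (x := g w) (y := c.1)]
      · have e1 : dist a.2 (g.symm c.2) = dist (g a.2) c.2 := by
          rw [← g.dist_eq a.2, g.apply_symm_apply]
        have e2 := dist_triangle (g a.1) (g w) c.1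
        rw [g.dist_eq] at e2
        rw [h, e1]
        linarith [hκR a ha c hc, dist_comm a.1 w]
    have hB : ∀ b ∈ R, κ ≤ dist (g b.1) w + dist (g b.2) v := by
      intro b hb
      rw [dist_comm (g b.2) v, hvE _ (Or.inr (Or.inl ⟨b, hb, rfl⟩))]
      rcases transport_cases hfin w (g b.2) with h | ⟨a, ha, h⟩
      · rw [h]
        linarith [dist_nonneg (x := g b.1) (y := w)]
      · have e2 := dist_triangle (g b.1) w a.1
        rw [h]
        linarith [hκR b hb a ha, dist_comm (g b.2) a.2]
    refine ⟨v, hfin.insert _, hR.insert hv1, ?_⟩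
    rintro b (rfl | hb) c (rfl | hc)
    · linarith [dist_comm w (g w), dist_comm v (g v)]
    · exact hA c hc
    · exact hB b hb
    · exact hκR b hb c hc
  have hsw : ∀ R, P R → P (Prod.swap '' R) := by
    rintro R ⟨h1, h2, h3⟩
    refine ⟨h1.image _, h2.swap, ?_⟩
    rintro _ ⟨b, hb, rfl⟩ _ ⟨c, hc, rfl⟩
    have := h3 b hb c hc
    simp only [Prod.fst_swap, Prod.snd_swap]
    linarith
  obtain ⟨h, -, D, hD, hDR⟩ := exists_isometryEquiv_of_backAndForth P (fun R h => h.2.1) forth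
    (fun R hR w => by
      obtain ⟨v, hv⟩ := forth _ (hsw R hR) w
      exact ⟨v, insert_of_image_swap (hsw _ hv)⟩)
    (R₀ := ∅) ⟨Set.finite_empty, by simp [IsometricRel], by simp⟩
  have hc : ∀ b c, κ ≤ dist (g b) c + dist (g (h b)) (h c) := by
    intro b c
    refine hD.denseRange_val.induction_on₂
      (p := fun b c => κ ≤ dist (g b) c + dist (g (h b)) (h c)) ?_ ?_ b c
    · refine isClosed_le continuous_const (Continuous.add ?_ ?_)
      · exact (g.continuous.comp continuous_fst).dist continuous_snd
      · exact (g.continuous.comp (h.continuous.comp continuous_fst)).dist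
          (h.continuous.comp continuous_snd)
    · rintro ⟨b, hb⟩ ⟨c, hc⟩
      obtain ⟨R, hR, h1, h2⟩ := hDR b hb c hc
      exact hR.2.2 _ h1 _ h2
  refine ⟨h, fun x => ?_⟩
  have := hc x (g x)
  rwa [dist_self, zero_add] at this

/-- A nontrivial normal subgroup contains an isometry that moves every point by `1`. The first
commutator moves every point by at least some `s > 0`, and each further one doubles this. -/
theorem exists_mem_normal_dist_eq_one [CompleteSpace U] [TopologicalSpace.SeparableSpace U]
    [Nonempty U] (hU : ∀ x y : U, dist x y ≤ 1) (hE : ExtensionProperty U)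
    (N : Subgroup (U ≃ᵢ U)) [N.Normal] (hN : N ≠ ⊥) : ∃ t ∈ N, ∀ x, dist x (t x) = 1 := by
  have comm : ∀ g ∈ N, ∀ h : U ≃ᵢ U, ∀ κ : ℝ, (∀ x, κ ≤ dist (g (h x)) (h (g x))) →
      ∃ k ∈ N, ∀ x, κ ≤ dist x (k x) := by
    intro g hg h κ hκ
    refine ⟨g⁻¹ * (h * g * h⁻¹), N.mul_mem (N.inv_mem hg) (Subgroup.Normal.conj_mem ‹_› g hg h),
      fun x => ?_⟩
    have := hκ (h⁻¹ x)
    rw [IsometryEquiv.apply_inv_self] at this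
    rwa [← g.dist_eq x, IsometryEquiv.mul_apply, IsometryEquiv.apply_inv_self]
  have double : ∀ s : ℝ, (∃ g ∈ N, ∀ x, s ≤ dist x (g x)) →
      ∃ g ∈ N, ∀ x, min 1 (2 * s) ≤ dist x (g x) := by
    rintro s ⟨g, hg, hs⟩
    obtain ⟨h, hh⟩ := exists_displaced_commutator hU g (min_le_left 1 (2 * s))
      (fun w p E hp hfin _ => by
        obtain ⟨v, hv⟩ := hE p hp E hfin
        exact ⟨v, (min_le_right _ _).trans (by linarith [hs w, hs v]), hv⟩)
    exact comm g hg h _ hh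
  obtain ⟨g, hg, hg1⟩ := N.bot_or_exists_ne_one.resolve_left hN
  obtain ⟨a₀, ha₀⟩ : ∃ a, g a ≠ a := by
    by_contra! h
    exact hg1 (IsometryEquiv.ext h)
  obtain ⟨s, hs⟩ : ∃ s, dist a₀ (g a₀) = 4 * s := ⟨dist a₀ (g a₀) / 4, by ring⟩
  have hs0 : 0 < s := by
    have := dist_pos.2 ha₀.symm
    linarith
  have hs1 : 4 * s ≤ 1 := hs ▸ hU _ _
  obtain ⟨h, hh⟩ := exists_displaced_commutator hU g (κ := s) (by linarith)
    (fun w p E hp hfin hκ => by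
      obtain ⟨v, hv, hvE⟩ := exists_displaced hU hE g hs0 hs hfin hp (r := s - dist w (g w))
        (by linarith [dist_nonneg (x := w) (y := g w)])
        (fun a ha b hb => by linarith [hκ a ha b hb])
      exact ⟨v, by linarith, hvE⟩)
  have hpow : ∀ n : ℕ, ∃ g ∈ N, ∀ x, min 1 (2 ^ n * s) ≤ dist x (g x) := by
    intro n
    induction n with
    | zero =>
      obtain ⟨k, hk, hk'⟩ := comm g hg h s hh
      exact ⟨k, hk, fun x => (min_le_right _ _).trans (by simpa using hk' x)⟩
    | succ n ih =>
      obtain ⟨k, hk, hk'⟩ := double _ ih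
      refine ⟨k, hk, fun x => le_trans ?_ (hk' x)⟩
      refine le_min (min_le_left _ _) ?_
      rw [mul_min_of_nonneg _ _ zero_le_two, pow_succ]
      exact le_min ((min_le_left _ _).trans (by norm_num)) ((min_le_right _ _).trans_eq (by ring))
  obtain ⟨n, hn⟩ := pow_unbounded_of_one_lt s⁻¹ one_lt_two
  obtain ⟨t, ht, ht'⟩ := hpow n
  refine ⟨t, ht, fun x => le_antisymm (hU _ _) (le_trans (le_min le_rfl ?_) (ht' x))⟩
  have := mul_le_mul_of_nonneg_right hn.le hs0.le
  rwa [inv_mul_cancel₀ hs0.ne'] at this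

end Displacement

/-! ### Realizing finite configurations -/

section Configuration

variable {U : Type*} [MetricSpace U]

/-- The extension property for several points: an isometric copy `y` of a finite set `C` is added to
points `pt k`, at prescribed distances `m b k`. -/
theorem exists_tuple (hU : ∀ x y : U, dist x y ≤ 1) (hE : ExtensionProperty U) {κ : Type*}
    [Finite κ] (pt : κ → U) (m : U → κ → ℝ) {C : Set U} (hC : C.Finite)
    (h1 : ∀ b ∈ C, ∀ k, m b k ≤ 1)
    (h2 : ∀ b ∈ C, ∀ k l, m b k ≤ m b l + dist (pt k) (pt l))
    (h3 : ∀ b ∈ C, ∀ k l, dist (pt k) (pt l) ≤ m b k + m b l)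
    (h4 : ∀ b ∈ C, ∀ c ∈ C, ∀ k, m b k ≤ m c k + dist b c)
    (h5 : ∀ b ∈ C, ∀ c ∈ C, ∀ k, dist b c ≤ m b k + m c k) :
    ∃ y : U → U, (∀ b ∈ C, ∀ c ∈ C, dist (y b) (y c) = dist b c) ∧
      ∀ b ∈ C, ∀ k, dist (y b) (pt k) = m b k := by
  induction C, hC using Set.Finite.induction_on with
  | empty => exact ⟨id, by simp, by simp⟩
  | @insert c C hc hC ih =>
    have hi : ∀ b ∈ C, b ∈ insert c C := fun b hb => Set.mem_insert_of_mem _ hb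
    have hcc : c ∈ insert c C := Set.mem_insert _ _
    obtain ⟨y, hy, hym⟩ := ih (fun b hb => h1 b (hi b hb)) (fun b hb => h2 b (hi b hb))
      (fun b hb => h3 b (hi b hb)) (fun b hb c hc => h4 b (hi b hb) c (hi c hc))
      (fun b hb c hc => h5 b (hi b hb) c (hi c hc))
    have := hC.to_subtype
    let a : κ ⊕ C → U := Sum.elim pt fun b => y b
    let w : κ ⊕ C → ℝ := Sum.elim (m c) fun b => dist c b
    have hK : IsKatetov (freeExt a w) := by
      refine isKatetov_freeExt hU ?_
      rintro (k | b) (l | d) <;> simp only [a, w, Sum.elim_inl, Sum.elim_inr]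
      · exact h3 c hcc k l
      · rw [dist_comm, hym d d.2]
        linarith [h4 d (hi d d.2) c hcc k, dist_comm c (d : U)]
      · rw [hym b b.2]
        linarith [h4 b (hi b b.2) c hcc l, dist_comm c (b : U)]
      · rw [hy b b.2 d d.2]
        exact dist_triangle_left _ _ _
    obtain ⟨x, hx⟩ := hE _ hK (Set.range pt ∪ y '' C) ((Set.finite_range pt).union (hC.image y))
    have hx1 : ∀ k, dist x (pt k) = m c k := fun k => by
      rw [hx _ (Or.inl ⟨k, rfl⟩)]
      refine le_antisymm (freeExt_le_weight (a := a) (w := w) (Sum.inl k))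
        (le_freeExt (h1 c hcc k) ?_)
      rintro (l | b) <;> simp only [a, w, Sum.elim_inl, Sum.elim_inr]
      · linarith [h2 c hcc k l, dist_comm (pt k) (pt l)]
      · rw [hym b b.2]
        linarith [h4 c hcc b (hi b b.2) k]
    have hx2 : ∀ b ∈ C, dist x (y b) = dist c b := fun b hb => by
      rw [hx _ (Or.inr ⟨b, hb, rfl⟩)]
      refine le_antisymm (freeExt_le_weight (a := a) (w := w) (Sum.inr ⟨b, hb⟩))
        (le_freeExt (hU _ _) ?_)
      rintro (l | d) <;> simp only [a, w, Sum.elim_inl, Sum.elim_inr]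
      · rw [dist_comm (pt l), hym b hb]
        exact h5 c hcc b (hi b hb) l
      · rw [hy d d.2 b hb]
        exact dist_triangle _ _ _
    classical
    have hup : ∀ b ∈ C, Function.update y c x b = y b := fun b hb =>
      Function.update_of_ne (fun h : b = c => hc (h ▸ hb)) _ _
    refine ⟨Function.update y c x, ?_, ?_⟩
    · rintro b (rfl | hb) d (rfl | hd)
      · simp
      · rw [Function.update_self, hup d hd, hx2 d hd]
      · rw [Function.update_self, hup b hb, dist_comm, hx2 b hb, dist_comm]
      · rw [hup b hb, hup d hd, hy b hb d hd]
    · rintro b (rfl | hb) k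
      · rw [Function.update_self, hx1]
      · rw [hup b hb, hym b hb]

/-! ### Extending finite maps to conjugates of an isometry -/

/-- The distance from `u` to the image of `c` under a generic perturbation of `s` that stays
`2 * ε`-close to `s` on `B`: the two points are joined through a point `x` of `B`, the
image `s x'` of a point of `B`, and the perturbation. -/
noncomputable def perturbDist (s : U ≃ᵢ U) (B : Set U) (ε : ℝ) (c : U) : U → ℝ :=
  freeExt (fun q : B × B => (q.1 : U))
    fun q : B × B => 2 * ε + dist (q.1 : U) (s q.2) + dist (q.2 : U) c

section PerturbDist

variable (s : U ≃ᵢ U) {B : Set U} (hB : B.Finite) (ε : ℝ)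

include hB

theorem perturbDist_cases (c u : U) : perturbDist s B ε c u = 1 ∨ ∃ x ∈ B, ∃ x' ∈ B,
    perturbDist s B ε c u = 2 * ε + dist x (s x') + dist x' c + dist x u := by
  have := hB.to_subtype
  rcases freeExt_cases (fun q : B × B => (q.1 : U))
    (fun q : B × B => 2 * ε + dist (q.1 : U) (s q.2) + dist (q.2 : U) c) u with h | ⟨q, h⟩
  · exact Or.inl h
  · exact Or.inr ⟨q.1, q.1.2, q.2, q.2.2, h⟩

theorem perturbDist_le (c u : U) {x x' : U} (hx : x ∈ B) (hx' : x' ∈ B) :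
    perturbDist s B ε c u ≤ 2 * ε + dist x (s x') + dist x' c + dist x u := by
  have := hB.to_subtype
  exact freeExt_le (a := fun q : B × B => (q.1 : U))
    (w := fun q : B × B => 2 * ε + dist (q.1 : U) (s q.2) + dist (q.2 : U) c) (⟨x, hx⟩, ⟨x', hx'⟩) u

theorem perturbDist_le_one (c u : U) : perturbDist s B ε c u ≤ 1 := by
  have := hB.to_subtype
  exact freeExt_le_one _

omit hB in
theorem le_perturbDist {c u : U} {r : ℝ} (h1 : r ≤ 1)
    (h : ∀ x ∈ B, ∀ x' ∈ B, r ≤ 2 * ε + dist x (s x') + dist x' c + dist x u) :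
    r ≤ perturbDist s B ε c u :=
  le_freeExt h1 fun q => h q.1 q.1.2 q.2 q.2.2

variable {ε} (hε : 0 ≤ ε)

include hε

theorem isKatetov_perturbDist (hU : ∀ x y : U, dist x y ≤ 1) (c : U) :
    IsKatetov (perturbDist s B ε c) := by
  have := hB.to_subtype
  refine isKatetov_freeExt hU fun p q => ?_
  have e1 := dist_triangle4 (p.1 : U) (s p.2) (s q.2) q.1
  rw [s.dist_eq] at e1
  linarith [dist_triangle_right (p.2 : U) q.2 c, dist_comm (q.1 : U) (s q.2)]

omit hε in
theorem perturbDist_le_add (c c' u : U) :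
    perturbDist s B ε c u ≤ perturbDist s B ε c' u + dist c c' := by
  rcases perturbDist_cases s hB ε c' u with h | ⟨x, hx, x', hx', h⟩
  · linarith [perturbDist_le_one s hB ε c u, dist_nonneg (x := c) (y := c')]
  · linarith [perturbDist_le s hB ε c u hx hx', dist_triangle x' c' c, dist_comm c c']

theorem dist_le_perturbDist_add (hU : ∀ x y : U, dist x y ≤ 1) (c c' u : U) :
    dist c c' ≤ perturbDist s B ε c u + perturbDist s B ε c' u := by
  have h0 := fun c => (isKatetov_perturbDist s hB hε hU c).nonneg u
  rcases perturbDist_cases s hB ε c u with h | ⟨x, hx, x', hx', h⟩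
  · linarith [hU c c', h0 c']
  rcases perturbDist_cases s hB ε c' u with h' | ⟨y, hy, y', hy', h'⟩
  · linarith [hU c c', h0 c]
  have e1 := dist_triangle4 c x' y' c'
  have e2 := dist_triangle4 (s x') x y (s y')
  rw [s.dist_eq] at e2
  linarith [dist_triangle_right x y u, dist_comm c x', dist_comm (s x') x]

theorem perturbDist_self (hs : ∀ x, dist x (s x) = 1) (c : U) :
    perturbDist s B ε c c = 1 := by
  refine le_antisymm (perturbDist_le_one s hB ε c c) (le_perturbDist s ε le_rfl fun x _ x' _ => ?_)
  have e1 := dist_triangle4 x' c x (s x')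
  rw [hs] at e1
  linarith [dist_comm x c]

end PerturbDist

/-- Finite pieces of conjugates of an isometry `s` that moves every point by `1`: a configuration
`α c ↦ β c` indexed by `c ∈ C` extends to a conjugate of `s` as soon as the distances between
`α a` and `β b` are those of a generic perturbation of `s`. If moreover `α` is close to the
identity, then so is the conjugating isometry.

One builds a copy `v` of `C` such that `v a` is a generic point at distance `ε` from `a` as far as
`B` is concerned, and `dist (v a) (s (v b))` is as required. The points `v a` are added one by one;
the type of the next one over the points `v b`, `s (v b)`, `s⁻¹ (v b)` is a free extension of
its type over `B` and the `v b` only, so no information on the action of `s ^ 2` is needed. -/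
theorem exists_conj_eq_on (hU : ∀ x y : U, dist x y ≤ 1) (hE : ExtensionProperty U)
    (hH : IsUltrahomogeneousMetric U) (s : U ≃ᵢ U) (hs : ∀ x, dist x (s x) = 1) {B C : Set U}
    (hB : B.Finite) (hC : C.Finite) {ε : ℝ} (hε : 0 ≤ ε) (α β : U → U)
    (hα : ∀ a ∈ C, ∀ b ∈ C, dist (α a) (α b) = dist a b)
    (hβ : ∀ a ∈ C, ∀ b ∈ C, dist (β a) (β b) = dist a b)
    (hαβ : ∀ a ∈ C, ∀ b ∈ C, dist (α a) (β b) = perturbDist s B ε b a) :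
    ∃ k : U ≃ᵢ U, (∀ c ∈ C, (k * s * k⁻¹) (α c) = β c) ∧
      ∀ c ∈ C, c ∈ B → dist (k c) (α c) ≤ ε := by
  have := hB.to_subtype
  -- `q c` is the type over `B` of the generic point at distance `ε` from `c`
  let q : U → U → ℝ := fun c => freeExt (fun x : B => (x : U)) fun x : B => ε + dist c x
  have hqle : ∀ c u, ∀ x ∈ B, q c u ≤ ε + dist c x + dist x u := fun c u x hx =>
    freeExt_le (a := fun x : B => (x : U)) (w := fun x : B => ε + dist c x) ⟨x, hx⟩ u
  have hq1 : ∀ c u, q c u ≤ 1 := fun c u => freeExt_le_one u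
  have hqc : ∀ c u, q c u = 1 ∨ ∃ x ∈ B, q c u = ε + dist c x + dist x u := fun c u => by
    rcases freeExt_cases (fun x : B => (x : U)) (fun x : B => ε + dist c x) u with h | ⟨x, h⟩
    · exact Or.inl h
    · exact Or.inr ⟨x, x.2, h⟩
  let F : Set U := B ∪ (s '' B ∪ s.symm '' B)
  have hF : F.Finite := hB.union ((hB.image _).union (hB.image _))
  obtain ⟨v, hv, hvs, hvF⟩ : ∃ v : U → U, (∀ a ∈ C, ∀ b ∈ C, dist (v a) (v b) = dist a b) ∧
      (∀ a ∈ C, ∀ b ∈ C, dist (v a) (s (v b)) = perturbDist s B ε b a) ∧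
      ∀ a ∈ C, ∀ u ∈ F, dist (v a) u = q a u := by
    clear hα hβ hαβ
    induction C, hC using Set.Finite.induction_on with
    | empty => exact ⟨id, by simp, by simp, by simp⟩
    | @insert c C hc hC ih =>
      obtain ⟨v, hv, hvs, hvF⟩ := ih
      have := hC.to_subtype
      let a : B ⊕ C → U := Sum.elim Subtype.val fun b => v b
      let w : B ⊕ C → ℝ := Sum.elim (fun x => ε + dist c x) fun b => dist c b
      have hxv : ∀ x ∈ B, ∀ b ∈ C, dist x (v b) ≤ ε + dist c x + dist c b := fun x hx b hb => by
        rw [dist_comm, hvF b hb x (Or.inl hx)]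
        have := hqle b x x hx
        rw [dist_self] at this
        linarith [dist_triangle b c x, dist_comm b c]
      have hK : IsKatetov (freeExt a w) := by
        refine isKatetov_freeExt hU ?_
        rintro (x | b) (y | d) <;> simp only [a, w, Sum.elim_inl, Sum.elim_inr]
        · linarith [dist_triangle_left (x : U) y c]
        · exact hxv x x.2 d d.2
        · linarith [hxv y y.2 b b.2, dist_comm (v b) (y : U)]
        · rw [hv b b.2 d d.2]
          exact dist_triangle_left _ _ _
      obtain ⟨z, hz⟩ := hE _ hK
        (F ∪ (v '' C ∪ ((fun b => s (v b)) '' C ∪ (fun b => s.symm (v b)) '' C)))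
        (hF.union ((hC.image _).union ((hC.image _).union (hC.image _))))
      have hwB : ∀ u, ∀ x ∈ B, freeExt a w u ≤ ε + dist c x + dist x u := fun u x hx =>
        freeExt_le (a := a) (w := w) (Sum.inl ⟨x, hx⟩) u
      have hzF : ∀ u ∈ F, dist z u = q c u := fun u hu => by
        rw [hz u (Or.inl hu)]
        refine le_antisymm (le_freeExt (freeExt_le_one _) fun x => hwB u x x.2)
          (le_freeExt (hq1 c u) ?_)
        rintro (x | b) <;> simp only [a, w, Sum.elim_inl, Sum.elim_inr]
        · exact hqle c u x x.2
        · rw [hvF b b.2 u hu]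
          rcases hqc b u with h | ⟨x, hx, h⟩
          · linarith [hq1 c u, dist_nonneg (x := c) (y := (b : U))]
          · linarith [hqle c u x hx, dist_triangle c b x]
      have hzv : ∀ b ∈ C, dist z (v b) = dist c b := fun b hb => by
        rw [hz _ (Or.inr (Or.inl ⟨b, hb, rfl⟩))]
        refine le_antisymm (freeExt_le_weight (a := a) (w := w) (Sum.inr ⟨b, hb⟩))
          (le_freeExt (hU _ _) ?_)
        rintro (x | d) <;> simp only [a, w, Sum.elim_inl, Sum.elim_inr]
        · rw [dist_comm (x : U), hvF b hb x (Or.inl x.2)]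
          rcases hqc b x with h | ⟨y, hy, h⟩
          · linarith [hU c b, dist_nonneg (x := c) (y := (x : U))]
          · linarith [dist_triangle4 c x y b, dist_comm (x : U) y, dist_comm b y]
        · rw [hv d d.2 b hb]
          exact dist_triangle _ _ _
      have hz1 : ∀ b ∈ C, dist z (s (v b)) = perturbDist s B ε b c := fun b hb => by
        rw [hz _ (Or.inr (Or.inr (Or.inl ⟨b, hb, rfl⟩)))]
        have e0 : ∀ x ∈ B, dist x (s (v b)) = q b (s.symm x) := fun x hx => by
          rw [← hvF b hb _ (Or.inr (Or.inr ⟨x, hx, rfl⟩)), ← s.dist_eq (v b), s.apply_symm_apply,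
            dist_comm]
        have e1 : ∀ x y, dist y (s.symm x) = dist x (s y) := fun x y => by
          rw [← s.dist_eq y, s.apply_symm_apply, dist_comm]
        refine le_antisymm (le_perturbDist s ε (freeExt_le_one _) fun x hx x' hx' => ?_)
          (le_freeExt (perturbDist_le_one s hB ε b c) ?_)
        · have h1 := hwB (s (v b)) x hx
          have h2 := hqle b (s.symm x) x' hx'
          rw [e0 x hx] at h1
          rw [e1] at h2
          linarith [dist_comm c x, dist_comm b x']
        · rintro (x | d) <;> simp only [a, w, Sum.elim_inl, Sum.elim_inr]
          · rw [e0 x x.2]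
            rcases hqc b (s.symm x) with h | ⟨y, hy, h⟩
            · linarith [perturbDist_le_one s hB ε b c, dist_nonneg (x := c) (y := (x : U))]
            · rw [e1] at h
              linarith [perturbDist_le s hB ε b c x.2 hy, dist_comm c x, dist_comm b y]
          · rw [hvs d d.2 b hb]
            rcases perturbDist_cases s hB ε b d with h | ⟨x, hx, y, hy, h⟩
            · linarith [perturbDist_le_one s hB ε b c, dist_nonneg (x := c) (y := (d : U))]
            · linarith [perturbDist_le s hB ε b c hx hy, dist_triangle x d c, dist_comm c (d : U)]
      have hz2 : ∀ b ∈ C, dist (v b) (s z) = perturbDist s B ε c b := fun b hb => by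
        have e0 : ∀ y, dist y (s.symm (v b)) = dist (s y) (v b) := fun y => by
          rw [← s.dist_eq y, s.apply_symm_apply]
        rw [dist_comm, ← e0, hz _ (Or.inr (Or.inr (Or.inr ⟨b, hb, rfl⟩)))]
        have e1 : ∀ x ∈ B, dist x (s.symm (v b)) = q b (s x) := fun x hx => by
          rw [e0, ← hvF b hb _ (Or.inr (Or.inl ⟨x, hx, rfl⟩)), dist_comm]
        refine le_antisymm (le_perturbDist s ε (freeExt_le_one _) fun x hx x' hx' => ?_)
          (le_freeExt (perturbDist_le_one s hB ε c b) ?_)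
        · have h1 := hwB (s.symm (v b)) x' hx'
          have h2 := hqle b (s x') x hx
          rw [e1 x' hx'] at h1
          linarith [dist_comm c x', dist_comm b x]
        · rintro (x | d) <;> simp only [a, w, Sum.elim_inl, Sum.elim_inr]
          · rw [e1 x x.2]
            rcases hqc b (s x) with h | ⟨y, hy, h⟩
            · linarith [perturbDist_le_one s hB ε c b, dist_nonneg (x := c) (y := (x : U))]
            · linarith [perturbDist_le s hB ε c b hy x.2, dist_comm c x, dist_comm b y]
          · rw [e0, dist_comm (s (v d)), hvs b hb d d.2]
            linarith [perturbDist_le_add (ε := ε) s hB c d b]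
      classical
      have hup : ∀ b ∈ C, Function.update v c z b = v b := fun b hb =>
        Function.update_of_ne (fun h : b = c => hc (h ▸ hb)) _ _
      refine ⟨Function.update v c z, ?_, ?_, ?_⟩
      · rintro b (rfl | hb) d (rfl | hd)
        · simp
        · rw [Function.update_self, hup d hd, hzv d hd]
        · rw [Function.update_self, hup b hb, dist_comm, hzv b hb, dist_comm]
        · rw [hup b hb, hup d hd, hv b hb d hd]
      · rintro b (rfl | hb) d (rfl | hd)
        · rw [Function.update_self, hs, perturbDist_self s hB hε hs]
        · rw [Function.update_self, hup d hd, hz1 d hd]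
        · rw [Function.update_self, hup b hb, hz2 b hb]
        · rw [hup b hb, hup d hd, hvs b hb d hd]
      · rintro b (rfl | hb) u hu
        · rw [Function.update_self, hzF u hu]
        · rw [hup b hb, hvF b hb u hu]
  have := hC.to_subtype
  obtain ⟨k, hk⟩ := hH.exists_isometryEquiv (ι := C ⊕ C)
    (Sum.elim (fun c => v c) fun c => s (v c)) (Sum.elim (fun c => α c) fun c => β c) (by
      rintro (a | a) (b | b) <;> simp only [Sum.elim_inl, Sum.elim_inr]
      · rw [hv a a.2 b b.2, hα a a.2 b b.2]
      · rw [hvs a a.2 b b.2, hαβ a a.2 b b.2]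
      · rw [dist_comm, hvs b b.2 a a.2, dist_comm, hαβ b b.2 a a.2]
      · rw [s.dist_eq, hv a a.2 b b.2, hβ a a.2 b b.2])
  have hk1 : ∀ c ∈ C, k (v c) = α c := fun c hc => hk (Sum.inl ⟨c, hc⟩)
  have hk2 : ∀ c ∈ C, k (s (v c)) = β c := fun c hc => hk (Sum.inr ⟨c, hc⟩)
  refine ⟨k, fun c hc => ?_, fun c hc hcB => ?_⟩
  · rw [← hk1 c hc, IsometryEquiv.mul_apply, IsometryEquiv.mul_apply, IsometryEquiv.inv_apply_self,
      hk2 c hc]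
  · rw [← hk1 c hc, k.dist_eq, dist_comm, hvF c hc c (Or.inl hcB)]
    have := hqle c c c hcB
    rw [dist_self] at this
    linarith

end Configuration

/-! ### Products of three conjugates -/

section Products

variable {U : Type*} [MetricSpace U]

theorem dist_conj_eq_one {t : U ≃ᵢ U} (ht : ∀ x, dist x (t x) = 1) (k : U ≃ᵢ U) (x : U) :
    dist x ((k * t * k⁻¹) x) = 1 := by
  have := ht (k⁻¹ x)
  rwa [← k.dist_eq, IsometryEquiv.apply_inv_self] at this

/-- An isometry `s` that moves every point by `1` can be conjugated, nearly fixing the points of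
`A`, such that the image of `K` becomes independent over `K` from a given finite set `Z`:
distances to points of `Z` are realized by paths through `K`, or equal to `1`. -/
theorem exists_conj_independent (hU : ∀ x y : U, dist x y ≤ 1) (hE : ExtensionProperty U)
    (hH : IsUltrahomogeneousMetric U) (s : U ≃ᵢ U) (hs : ∀ x, dist x (s x) = 1) {A K Z : Set U}
    (hA : A ⊆ K) (hK : K.Finite) (hZ : Z.Finite) {ε : ℝ} (hε : 0 ≤ ε) :
    ∃ k : U ≃ᵢ U, (∀ x ∈ A, dist (k x) x ≤ ε) ∧
      ∀ b ∈ K, ∀ u ∈ Z, 1 ≤ dist ((k * s * k⁻¹) b) u ∨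
        ∃ x ∈ K, dist ((k * s * k⁻¹) b) x + dist x u ≤ dist ((k * s * k⁻¹) b) u := by
  have hAf := hK.subset hA
  have := (hK.union hZ).to_subtype
  have hP := isKatetov_perturbDist s hAf hε hU
  obtain ⟨y, hy, hym⟩ := exists_tuple hU hE (fun u : (K ∪ Z : Set U) => (u : U))
    (fun b u => perturbDist s A ε b u) hK (fun b _ k => (hP b).le_one _)
    (fun b _ k l => (hP b).lip _ _) (fun b _ k l => (hP b).dist_le _ _)
    (fun b _ c _ k => perturbDist_le_add s hAf b c k)
    (fun b _ c _ k => dist_le_perturbDist_add s hAf hε hU b c k)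
  have hyK : ∀ b ∈ K, ∀ u ∈ K, dist (y b) u = perturbDist s A ε b u := fun b hb u hu =>
    hym b hb ⟨u, Or.inl hu⟩
  have hyZ : ∀ b ∈ K, ∀ u ∈ Z, dist (y b) u = perturbDist s A ε b u := fun b hb u hu =>
    hym b hb ⟨u, Or.inr hu⟩
  obtain ⟨k, hk, hk'⟩ := exists_conj_eq_on hU hE hH s hs hAf hK hε id y (fun _ _ _ _ => rfl) hy
    (fun a ha b hb => by rw [dist_comm, id, hyK b hb a ha])
  refine ⟨k, fun x hx => hk' x (hA hx) hx, fun b hb u hu => ?_⟩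
  have hkb : (k * s * k⁻¹) b = y b := hk b hb
  rw [hkb, hyZ b hb u hu]
  rcases perturbDist_cases s hAf ε b u with h | ⟨x, hx, x', hx', h⟩
  · exact Or.inl h.ge
  · refine Or.inr ⟨x, hA hx, ?_⟩
    rw [hyK b hb x (hA hx)]
    have := perturbDist_le s hAf ε b x hx hx'
    rw [dist_self] at this
    linarith

/-- `s K` and `r (s' K)` are independent over `K` and `s' K`: distances between points of
`K ∪ s K` and of `s' K ∪ r (s' K)` are realized by paths that pass through `K` first and then
through `s' K`, or are equal to `1`. -/
def IsIndependent (s s' r : U ≃ᵢ U) (K : Set U) : Prop :=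
  ∀ p ∈ K ∪ s '' K, ∀ q ∈ s' '' K ∪ r '' (s' '' K),
    1 ≤ dist p q ∨ ∃ k ∈ K, ∃ l ∈ s' '' K, dist p k + dist k l + dist l q ≤ dist p q

theorem exists_conj_isIndependent (hU : ∀ x y : U, dist x y ≤ 1) (hE : ExtensionProperty U)
    (hH : IsUltrahomogeneousMetric U) (s s' r : U ≃ᵢ U) (hs : ∀ x, dist x (s x) = 1)
    (hr : ∀ x, dist x (r x) = 1) {A : Set U} (hA : A.Finite) {ε : ℝ} (hε : 0 ≤ ε) :
    ∃ (k k' : U ≃ᵢ U) (K : Set U), K.Finite ∧ A ⊆ K ∧ A ⊆ s' '' K ∧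
      (∀ x ∈ A, dist (k x) x ≤ ε) ∧ (∀ x ∈ A, dist (k' x) x ≤ ε) ∧
      IsIndependent (k * s * k⁻¹) s' (k' * r * k'⁻¹) K := by
  let K : Set U := A ∪ s'.symm '' A
  have hK : K.Finite := hA.union (hA.image _)
  have hAK : A ⊆ K := Set.subset_union_left
  have hAL : A ⊆ s' '' K := fun x hx => ⟨s'.symm x, Or.inr ⟨x, hx, rfl⟩, s'.apply_symm_apply x⟩
  have hL := hK.image s'
  obtain ⟨k, hk, hkK⟩ := exists_conj_independent hU hE hH s hs hAK hK hL hε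
  obtain ⟨k', hk', hkL⟩ := exists_conj_independent hU hE hH r hr hAL hL
    (hK.union (hK.image (k * s * k⁻¹))) hε
  refine ⟨k, k', K, hK, hAK, hAL, hk, hk', ?_⟩
  have hpl : ∀ p ∈ K ∪ (k * s * k⁻¹) '' K, ∀ l ∈ s' '' K,
      1 ≤ dist p l ∨ ∃ k ∈ K, dist p k + dist k l ≤ dist p l := by
    rintro p (hp | ⟨b, hb, rfl⟩) l hl
    · exact Or.inr ⟨p, hp, by rw [dist_self, zero_add]⟩
    · exact hkK b hb l hl
  rintro p hp q (hq | ⟨b, hb, rfl⟩)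
  · rcases hpl p hp q hq with h | ⟨x, hx, h⟩
    · exact Or.inl h
    · exact Or.inr ⟨x, hx, q, hq, by rwa [dist_self, add_zero]⟩
  · rcases hkL b hb p hp with h | ⟨l, hl, h⟩
    · rw [dist_comm] at h
      exact Or.inl h
    · have e1 := dist_comm p ((k' * r * k'⁻¹) b)
      have e2 := dist_comm l ((k' * r * k'⁻¹) b)
      have e3 := dist_comm l p
      rcases hpl p hp l hl with h' | ⟨x, hx, h'⟩
      · exact Or.inl (by linarith [dist_nonneg (x := l) (y := (k' * r * k'⁻¹) b)])
      · exact Or.inr ⟨x, hx, l, hl, by linarith⟩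

/-- Suppose that `s K` and `r (s' K)` are independent. Then every isometry `f` that is close to
`r⁻¹ * s' * s` on the finite set `s⁻¹ K` agrees on any given finite set `C` with a product of
conjugates of `r⁻¹`, `s'` and `s` by isometries that nearly fix the points of `K`,
respectively of `s' K`.

The successive images `y₁ c` and `y₂ c` of the points `c` of `C` are chosen generically:
`P c` and `T c` prescribe the types of `y₁ c` and `y₂ c`
over the ends of the paths, `Q` the distances between `y₁ c` and `y₂ e`. Since `Q` only uses
paths through `K` and `s' K`, the three prescriptions are compatible, and `r⁻¹ * s' * s` enters only
through its values on `s⁻¹ K`. -/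
theorem exists_conj_mul_eq_on (hU : ∀ x y : U, dist x y ≤ 1) (hE : ExtensionProperty U)
    (hH : IsUltrahomogeneousMetric U) (s s' r : U ≃ᵢ U) (hs : ∀ x, dist x (s x) = 1)
    (hs' : ∀ x, dist x (s' x) = 1) (hr : ∀ x, dist x (r x) = 1) {K : Set U} (hK : K.Finite)
    (hind : IsIndependent s s' r K) {ε : ℝ} (hε : 0 ≤ ε) (f : U ≃ᵢ U)
    (hf : ∀ x ∈ K, dist (f (s.symm x)) (r.symm (s' x)) ≤ 2 * ε) {C₀ : Set U} (hC₀ : C₀.Finite) :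
    ∃ k k' l : U ≃ᵢ U, (∀ c ∈ C₀, ((l * r * l⁻¹)⁻¹ * (k' * s' * k'⁻¹) * (k * s * k⁻¹)) c = f c) ∧
      (∀ x ∈ K, dist (k x) x ≤ ε) ∧ (∀ x ∈ K, dist (k' x) x ≤ 3 * ε) ∧
      ∀ x ∈ s' '' K, dist (l x) x ≤ ε := by
  let B : Set U := K ∪ s.symm '' K
  let B' : Set U := s' '' K ∪ r.symm '' (s' '' K)
  have hB : B.Finite := hK.union (hK.image _)
  have hB' : B'.Finite := (hK.image _).union ((hK.image _).image _)
  let C : Set U := C₀ ∪ (B ∪ f.symm '' B')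
  have hC : C.Finite := hC₀.union (hB.union (hB'.image _))
  let P : U → U → ℝ := perturbDist s B ε
  let T : U → U → ℝ := fun e => perturbDist r B' ε (f e)
  let Q : U → U → ℝ := fun e b => perturbDist s' K ε (s e) (s b)
  have hP : ∀ b, IsKatetov (P b) := isKatetov_perturbDist s hB hε hU
  have hT : ∀ e, IsKatetov (T e) := fun e => isKatetov_perturbDist r hB' hε hU (f e)
  have hQ : ∀ e, IsKatetov (perturbDist s' K ε (s e)) := fun e =>
    isKatetov_perturbDist s' hK hε hU (s e)
  -- `f` maps distances from points of `s⁻¹ K` approximately as `r⁻¹ * s' * s` does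
  have hfe : ∀ x ∈ K, ∀ e, dist x (s e) ≤ dist (r.symm (s' x)) (f e) + 2 * ε ∧
      dist (r.symm (s' x)) (f e) ≤ dist x (s e) + 2 * ε := by
    intro x hx e
    have e0 : dist x (s e) = dist (f (s.symm x)) (f e) := by
      rw [f.dist_eq, ← s.dist_eq (s.symm x) e, s.apply_symm_apply]
    have e1 := dist_triangle_left (f (s.symm x)) (f e) (r.symm (s' x))
    have e2 := dist_triangle_left (r.symm (s' x)) (f e) (f (s.symm x))
    rw [e0]
    constructor <;> linarith [hf x hx, dist_comm (f (s.symm x)) (r.symm (s' x))]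
  have hrs : ∀ x y, dist (r.symm x) y = dist x (r y) := fun x y => by
    rw [← r.dist_eq (r.symm x) y, r.apply_symm_apply]
  have hss : ∀ x y, dist (s.symm x) y = dist x (s y) := fun x y => by
    rw [← s.dist_eq (s.symm x) y, s.apply_symm_apply]
  have hQTP : ∀ e b u, Q e b ≤ T e u + P b u := by
    intro e b u
    have hQ1 : Q e b ≤ 1 := (hQ e).le_one _
    rcases perturbDist_cases s hB ε b u with h | ⟨x, hx, x', hx', h⟩
    · change P b u = 1 at h
      linarith [(hT e).nonneg u]
    rcases perturbDist_cases r hB' ε (f e) u with h' | ⟨z, hz, z', hz', h'⟩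
    · change T e u = 1 at h'
      linarith [(hP b).nonneg u]
    change P b u = _ at h
    change T e u = _ at h'
    have e1 := dist_triangle4 (s x') x z (r z')
    have e2 := dist_triangle_right x z u
    have hp : s x' ∈ K ∪ s '' K := by
      rcases hx' with hx' | ⟨w, hw, rfl⟩
      · exact Or.inr ⟨x', hx', rfl⟩
      · rw [s.apply_symm_apply]
        exact Or.inl hw
    have hq : r z' ∈ s' '' K ∪ r '' (s' '' K) := by
      rcases hz' with hz' | ⟨w, hw, rfl⟩
      · exact Or.inr ⟨z', hz', rfl⟩
      · rw [r.apply_symm_apply]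
        exact Or.inl hw
    rcases hind _ hp _ hq with h1 | ⟨k, hk, _, ⟨k', hk', rfl⟩, h1⟩
    · linarith [dist_comm x (s x'), dist_nonneg (x := x') (y := b),
        dist_nonneg (x := z') (y := f e)]
    · have e3 : Q e b ≤ _ := perturbDist_le s' hK ε (s e) (s b) hk hk'
      have e4 := (hfe k' hk' e).1
      have e5 := dist_triangle (r.symm (s' k')) z' (f e)
      rw [hrs (s' k') z'] at e5
      have e6 := dist_triangle k (s x') (s b)
      rw [s.dist_eq] at e6
      linarith [dist_comm x (s x'), dist_comm k (s x')]
  have hPTQ : ∀ e b u, P b u ≤ T e u + Q e b := by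
    intro e b u
    have hP1 : P b u ≤ 1 := (hP b).le_one u
    rcases perturbDist_cases r hB' ε (f e) u with h' | ⟨z, hz, z', hz', h'⟩
    · change T e u = 1 at h'
      linarith [(hQ e).nonneg (s b)]
    rcases perturbDist_cases s' hK ε (s e) (s b) with h | ⟨k, hk, k', hk', h⟩
    · change Q e b = 1 at h
      linarith [(hT e).nonneg u]
    change T e u = _ at h'
    change Q e b = _ at h
    have e1 : P b u ≤ _ :=
      perturbDist_le s hB ε b u (x := k) (x' := s.symm k) (Or.inl hk) (Or.inr ⟨k, hk, rfl⟩)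
    rw [s.apply_symm_apply, dist_self, hss] at e1
    have e2 := dist_triangle4 k (s' k') (r z') u
    have e3 := dist_triangle (r z') z u
    have e4 := dist_triangle_right (r.symm (s' k')) z' (f e)
    rw [hrs (s' k') z'] at e4
    linarith [(hfe k' hk' e).2, dist_comm z (r z')]
  have hTQP : ∀ e b u, T e u ≤ Q e b + P b u := by
    intro e b u
    have hT1 : T e u ≤ 1 := (hT e).le_one u
    rcases perturbDist_cases s hB ε b u with h | ⟨x, hx, x', hx', h⟩
    · change P b u = 1 at h
      linarith [(hQ e).nonneg (s b)]
    rcases perturbDist_cases s' hK ε (s e) (s b) with h' | ⟨k, hk, k', hk', h'⟩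
    · change Q e b = 1 at h'
      linarith [(hP b).nonneg u]
    change P b u = _ at h
    change Q e b = _ at h'
    have e1 : T e u ≤ _ := perturbDist_le r hB' ε (f e) u (x := s' k') (x' := r.symm (s' k'))
      (Or.inl ⟨k', hk', rfl⟩) (Or.inr ⟨s' k', ⟨k', hk', rfl⟩, rfl⟩)
    rw [r.apply_symm_apply, dist_self] at e1
    have e2 := dist_triangle4 (s' k') k (s b) u
    have e3 := dist_triangle4 (s b) (s x') x u
    rw [s.dist_eq] at e3
    linarith [(hfe k' hk' e).2, dist_comm x (s x'), dist_comm k (s' k'), dist_comm b x']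
  -- the points `y₁ c` after the first step
  let Z : Set U := K ∪ (C ∪ f '' C)
  have := (hK.union (hC.union (hC.image f))).to_subtype
  have := hC.to_subtype
  obtain ⟨y₁, hy₁, hy₁m⟩ := exists_tuple hU hE (fun u : Z => (u : U)) (fun b u => P b u) hC
    (fun b _ k => (hP b).le_one _) (fun b _ k l => (hP b).lip _ _)
    (fun b _ k l => (hP b).dist_le _ _) (fun b _ c _ k => perturbDist_le_add s hB b c k)
    (fun b _ c _ k => dist_le_perturbDist_add s hB hε hU b c k)
  -- the points `y₂ e` after the second step
  obtain ⟨y₂, hy₂, hy₂m⟩ := exists_tuple hU hE (Sum.elim (fun u : Z => (u : U)) fun b : C => y₁ b)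
    (fun e => Sum.elim (fun u => T e u) fun b => Q e b) hC
    (by
      rintro e - (u | b)
      · exact (hT e).le_one _
      · exact (hQ e).le_one _)
    (by
      rintro e - (u | b) (u' | b') <;> simp only [Sum.elim_inl, Sum.elim_inr]
      · exact (hT e).lip _ _
      · rw [dist_comm, hy₁m b' b'.2]
        exact hTQP e b' u
      · rw [hy₁m b b.2]
        exact hQTP e b u'
      · rw [hy₁ b b.2 b' b'.2, ← s.dist_eq]
        exact (hQ e).lip _ _)
    (by
      rintro e - (u | b) (u' | b') <;> simp only [Sum.elim_inl, Sum.elim_inr]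
      · exact (hT e).dist_le _ _
      · rw [dist_comm, hy₁m b' b'.2]
        exact hPTQ e b' u
      · rw [hy₁m b b.2, add_comm]
        exact hPTQ e b u'
      · rw [hy₁ b b.2 b' b'.2, ← s.dist_eq]
        exact (hQ e).dist_le _ _)
    (by
      rintro e - c - (u | b) <;> simp only [Sum.elim_inl, Sum.elim_inr]
      · rw [← f.dist_eq]
        exact perturbDist_le_add r hB' _ _ _
      · rw [← s.dist_eq e]
        exact perturbDist_le_add s' hK _ _ _)
    (by
      rintro e - c - (u | b) <;> simp only [Sum.elim_inl, Sum.elim_inr]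
      · rw [← f.dist_eq]
        exact dist_le_perturbDist_add r hB' hε hU _ _ _
      · rw [← s.dist_eq e]
        exact dist_le_perturbDist_add s' hK hε hU _ _ _)
  have hBC : B ⊆ C := fun x hx => Or.inr (Or.inl hx)
  -- each of the three steps extends to a conjugate
  obtain ⟨k, hk, hk1⟩ := exists_conj_eq_on hU hE hH s hs hB hC hε id y₁ (fun _ _ _ _ => rfl) hy₁
    (fun a ha b hb => by
      rw [dist_comm]
      exact hy₁m b hb ⟨a, Or.inr (Or.inl ha)⟩)
  obtain ⟨k', hk', hk'1⟩ := exists_conj_eq_on hU hE hH s' hs' hK (hC.image s) hε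
    (fun x => y₁ (s.symm x)) (fun x => y₂ (s.symm x))
    (by
      rintro _ ⟨a, ha, rfl⟩ _ ⟨b, hb, rfl⟩
      rw [s.symm_apply_apply, s.symm_apply_apply, s.dist_eq, hy₁ a ha b hb])
    (by
      rintro _ ⟨a, ha, rfl⟩ _ ⟨b, hb, rfl⟩
      rw [s.symm_apply_apply, s.symm_apply_apply, s.dist_eq, hy₂ a ha b hb])
    (by
      rintro _ ⟨a, ha, rfl⟩ _ ⟨b, hb, rfl⟩
      rw [s.symm_apply_apply, s.symm_apply_apply, dist_comm]
      exact hy₂m b hb (Sum.inr ⟨a, ha⟩))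
  obtain ⟨l, hl, hl1⟩ := exists_conj_eq_on hU hE hH r hr hB' (hC.image f) hε
    id (fun x => y₂ (f.symm x)) (fun _ _ _ _ => rfl)
    (by
      rintro _ ⟨a, ha, rfl⟩ _ ⟨b, hb, rfl⟩
      rw [f.symm_apply_apply, f.symm_apply_apply, f.dist_eq, hy₂ a ha b hb])
    (by
      rintro _ ⟨a, ha, rfl⟩ _ ⟨b, hb, rfl⟩
      rw [f.symm_apply_apply, dist_comm]
      exact hy₂m b hb (Sum.inl ⟨f a, Or.inr (Or.inr ⟨a, ha, rfl⟩)⟩))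
  refine ⟨k, k', l, fun c hc => ?_, fun x hx => ?_, fun x hx => ?_, fun x hx => ?_⟩
  · have hcC : c ∈ C := Or.inl hc
    have e1 : (k * s * k⁻¹) c = y₁ c := hk c hcC
    have e2 := hk' (s c) ⟨c, hcC, rfl⟩
    have e3 : (l * r * l⁻¹) (f c) = _ := hl (f c) ⟨c, hcC, rfl⟩
    rw [s.symm_apply_apply] at e2
    rw [f.symm_apply_apply] at e3
    rw [IsometryEquiv.mul_apply, IsometryEquiv.mul_apply, e1, e2, ← e3,
      IsometryEquiv.inv_apply_self]
  · exact hk1 x (hBC (Or.inl hx)) (Or.inl hx)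
  · have hxC : s.symm x ∈ C := hBC (Or.inr ⟨x, hx, rfl⟩)
    have e1 := hk'1 x ⟨s.symm x, hxC, s.apply_symm_apply x⟩ hx
    -- `y₁ (s⁻¹ x)` is within `2 * ε` of `x`
    have e2 : dist (y₁ (s.symm x)) x = P (s.symm x) x := hy₁m _ hxC ⟨x, Or.inl hx⟩
    have e3 : P (s.symm x) x ≤ _ := perturbDist_le s hB ε (s.symm x) x (x := x) (x' := s.symm x)
      (Or.inl hx) (Or.inr ⟨x, hx, rfl⟩)
    rw [s.apply_symm_apply, dist_self, dist_self] at e3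
    linarith [dist_triangle (k' x) (y₁ (s.symm x)) x]
  · exact hl1 x ⟨f.symm x, Or.inr (Or.inr ⟨x, Or.inl hx, rfl⟩), f.apply_symm_apply x⟩ (Or.inl hx)

/-- Products of three conjugates are somewhere dense: near given conjugating isometries there is a
product of conjugates such that all isometries close to it on a finite set `S` can be obtained,
exactly on any finite set, by small changes of the conjugating isometries. -/
theorem exists_conj_somewhere_dense (hU : ∀ x y : U, dist x y ≤ 1) (hE : ExtensionProperty U)
    (hH : IsUltrahomogeneousMetric U) (s s' r : U ≃ᵢ U) (hs : ∀ x, dist x (s x) = 1)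
    (hs' : ∀ x, dist x (s' x) = 1) (hr : ∀ x, dist x (r x) = 1) {A : Set U} (hA : A.Finite)
    {ε : ℝ} (hε : 0 < ε) :
    ∃ (p : U ≃ᵢ U) (S : Set U) (δ : ℝ), S.Finite ∧ 0 < δ ∧
      ∀ f : U ≃ᵢ U, (∀ x ∈ S, dist (f x) (p x) < δ) → ∀ C : Set U, C.Finite →
        ∃ k k' l : U ≃ᵢ U,
          (∀ c ∈ C, ((l * r * l⁻¹)⁻¹ * (k' * s' * k'⁻¹) * (k * s * k⁻¹)) c = f c) ∧
          (∀ x ∈ A, dist (k x) x ≤ ε) ∧ (∀ x ∈ A, dist (k' x) x ≤ ε) ∧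
          ∀ x ∈ A, dist (l x) x ≤ ε := by
  have hη : 0 < ε / 3 := by positivity
  obtain ⟨k, l, K, hK, hAK, hAL, hk, hl, hind⟩ :=
    exists_conj_isIndependent hU hE hH s s' r hs hr hA hη.le
  let s₁ := k * s * k⁻¹
  let r₁ := l * r * l⁻¹
  refine ⟨r₁⁻¹ * s' * s₁, s₁.symm '' K, 2 * (ε / 3), hK.image _, by positivity,
    fun f hf C hC => ?_⟩
  obtain ⟨m, m', n, h1, h2, h3, h4⟩ := exists_conj_mul_eq_on hU hE hH s₁ s' r₁
    (dist_conj_eq_one hs k) hs'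
    (dist_conj_eq_one hr l) hK hind hη.le f (fun x hx => by
      have := (hf _ ⟨x, hx, rfl⟩).le
      rw [IsometryEquiv.mul_apply, IsometryEquiv.mul_apply, s₁.apply_symm_apply] at this
      exact this) hC
  have htri : ∀ (m k : U ≃ᵢ U) (x : U), dist ((m * k) x) x ≤ dist (k x) x + dist (m x) x :=
    fun m k x => by
      have := dist_triangle (m (k x)) (m x) x
      rwa [m.dist_eq] at this
  refine ⟨m * k, m', n * l, fun c hc => ?_, fun x hx => ?_, fun x hx => ?_, fun x hx => ?_⟩
  · rw [← h1 c hc]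
    simp only [s₁, r₁, mul_inv_rev, mul_assoc]
  · linarith [htri m k x, hk x hx, h2 x (hAK hx)]
  · linarith [h3 x (hAK hx)]
  · linarith [htri n l x, hl x hx, h4 x (hAL hx)]

end Products

/-! ### Maps with somewhere dense images of open sets -/

section SomewhereDense

open Topology

/-- One move of the zigzag below: inside the open set `W`, whose image is dense in `O`, there are a
small closed ball around `x` that is mapped into `O`, and a smaller open set `O'` in which
the image of the open ball is dense. -/
theorem exists_ball_of_subset_closure_image {X Y : Type*} [MetricSpace X] [TopologicalSpace Y]
    {φ : X → Y} (hφ : Continuous φ)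
    (hd : ∀ W : Set X, IsOpen W → W.Nonempty → (interior (closure (φ '' W))).Nonempty)
    {W : Set X} (hW : IsOpen W) {O : Set Y} (hO : IsOpen O) (hO' : O.Nonempty)
    (hWO : O ⊆ closure (φ '' W)) {ε : ℝ} (hε : 0 < ε) :
    ∃ (x : X) (r : ℝ) (O' : Set Y), r ≤ ε ∧ Metric.closedBall x r ⊆ W ∧ IsOpen O' ∧
      O'.Nonempty ∧ O' ⊆ O ∧ O' ⊆ closure (φ '' Metric.ball x r) := by
  obtain ⟨y, hy⟩ := hO'
  obtain ⟨_, hxO, x, hxW, rfl⟩ := mem_closure_iff.1 (hWO hy) O hO hy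
  obtain ⟨r, hr, hrx⟩ := Metric.nhds_basis_closedBall.mem_iff.1
    ((hW.inter (hO.preimage hφ)).mem_nhds ⟨hxW, hxO⟩)
  have hr' : 0 < min r ε := lt_min hr hε
  have hsub : Metric.closedBall x (min r ε) ⊆ W ∩ φ ⁻¹' O :=
    (Metric.closedBall_subset_closedBall (min_le_left _ _)).trans hrx
  refine ⟨x, min r ε, interior (closure (φ '' Metric.ball x (min r ε))) ∩ O, min_le_right _ _,
    hsub.trans Set.inter_subset_left, isOpen_interior.inter hO, ?_, Set.inter_subset_right,
    Set.inter_subset_left.trans interior_subset⟩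
  obtain ⟨z, hz⟩ := hd _ Metric.isOpen_ball ⟨x, Metric.mem_ball_self hr'⟩
  obtain ⟨_, hw, v, hv, rfl⟩ := mem_closure_iff.1 (interior_subset hz) _ isOpen_interior hz
  exact ⟨_, hw, (hsub (Metric.ball_subset_closedBall hv)).2⟩

/-- Two continuous maps with dense ranges on a complete space, for which all images of nonempty
open sets are somewhere dense, have a common value. -/
theorem exists_eq_of_somewhere_dense {X Y : Type*} [MetricSpace X] [CompleteSpace X] [Nonempty X]
    [TopologicalSpace Y] [T2Space Y] {φ ψ : X → Y} (hφ : Continuous φ) (hψ : Continuous ψ)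
    (hφr : DenseRange φ) (hψr : DenseRange ψ)
    (hφd : ∀ W : Set X, IsOpen W → W.Nonempty → (interior (closure (φ '' W))).Nonempty)
    (hψd : ∀ W : Set X, IsOpen W → W.Nonempty → (interior (closure (ψ '' W))).Nonempty) :
    ∃ x x', φ x = ψ x' := by
  -- the states of the zigzag: open sets `W`, `W'` and an open set in which both images are dense
  let Q : Set X × Set X × Set Y → Prop := fun w => IsOpen w.1 ∧ IsOpen w.2.1 ∧ IsOpen w.2.2 ∧
    w.2.2.Nonempty ∧ w.2.2 ⊆ closure (φ '' w.1) ∧ w.2.2 ⊆ closure (ψ '' w.2.1)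
  have step : ∀ (n : ℕ) (w : {w // Q w}), ∃ w' : {w // Q w},
      (∃ x r, r ≤ 1 / ((n : ℝ) + 1) ∧ w'.1.1 ⊆ Metric.closedBall x r ∧
        Metric.closedBall x r ⊆ w.1.1) ∧
      (∃ x r, r ≤ 1 / ((n : ℝ) + 1) ∧ w'.1.2.1 ⊆ Metric.closedBall x r ∧
        Metric.closedBall x r ⊆ w.1.2.1) := by
    rintro n ⟨⟨W, W', O⟩, hW, hW', hO, hO', h1, h2⟩
    have hn : (0 : ℝ) < 1 / ((n : ℝ) + 1) := by positivity
    obtain ⟨x, r, O₁, hr, hx, hO₁, hO₁', hsub, hx'⟩ :=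
      exists_ball_of_subset_closure_image hφ hφd hW hO hO' h1 hn
    obtain ⟨y, s, O₂, hs, hy, hO₂, hO₂', hsub', hy'⟩ :=
      exists_ball_of_subset_closure_image hψ hψd hW' hO₁ hO₁' (hsub.trans h2) hn
    exact ⟨⟨(Metric.ball x r, Metric.ball y s, O₂), Metric.isOpen_ball, Metric.isOpen_ball, hO₂,
      hO₂', hsub'.trans hx', hy'⟩, ⟨x, r, hr, Metric.ball_subset_closedBall, hx⟩,
      ⟨y, s, hs, Metric.ball_subset_closedBall, hy⟩⟩
  choose F hF1 hF2 using step
  obtain ⟨x₀⟩ := ‹Nonempty X›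
  let w₀ : {w // Q w} := ⟨(Set.univ, Set.univ, Set.univ), isOpen_univ, isOpen_univ, isOpen_univ,
    ⟨φ x₀, trivial⟩, by rw [Set.image_univ, hφr.closure_range],
    by rw [Set.image_univ, hψr.closure_range]⟩
  let w : ℕ → {w // Q w} := fun n => Nat.rec w₀ (fun n v => F n v) n
  -- nested closed balls of radii tending to `0` have a common point
  have key : ∀ V : ℕ → Set X, (∀ n, (V n).Nonempty) →
      (∀ n : ℕ, ∃ x r, r ≤ 1 / ((n : ℝ) + 1) ∧ V (n + 1) ⊆ Metric.closedBall x r ∧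
        Metric.closedBall x r ⊆ V n) →
      ∃ z, ∀ G : Set X, G ∈ 𝓝 z → ∃ n, ∀ m ≥ n, V m ⊆ G := by
    intro V hV h
    choose c r hr h1 h2 using h
    have hanti : Antitone V := antitone_nat_of_succ_le fun n => (h1 n).trans (h2 n)
    have hc : ∀ n m, n < m → V m ⊆ Metric.closedBall (c n) (r n) := fun n m hnm =>
      (hanti hnm).trans (h1 n)
    have hr0 : ∀ n, 0 ≤ r n := fun n => by
      obtain ⟨v, hv⟩ := hV (n + 1)
      exact dist_nonneg.trans (Metric.mem_closedBall.1 (h1 n hv))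
    have hlim : Filter.Tendsto r Filter.atTop (𝓝 0) :=
      squeeze_zero hr0 hr tendsto_one_div_add_atTop_nhds_zero_nat
    obtain ⟨z, hz⟩ := Metric.nonempty_iInter_of_nonempty_biInter
      (s := fun n => Metric.closedBall (c n) (r n)) (fun n => Metric.isClosed_closedBall)
      (fun n => Metric.isBounded_closedBall)
      (fun N => by
        obtain ⟨v, hv⟩ := hV (N + 1)
        exact ⟨v, Set.mem_iInter₂.2 fun n hn => hc n (N + 1) (Nat.lt_succ_of_le hn) hv⟩)
      (squeeze_zero (fun n => Metric.diam_nonneg)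
        (fun n => Metric.diam_closedBall (hr0 n)) (by simpa using hlim.const_mul 2))
    refine ⟨z, fun G hG => ?_⟩
    obtain ⟨ε, hε, hG⟩ := Metric.mem_nhds_iff.1 hG
    obtain ⟨n, hn⟩ := (hlim.eventually_lt_const (half_pos hε)).exists
    refine ⟨n + 1, fun m hm => fun v hv => hG ?_⟩
    have e1 := Metric.mem_closedBall.1 (hc n m hm hv)
    have e2 := Metric.mem_closedBall.1 (Set.mem_iInter.1 hz n)
    rw [Metric.mem_ball]
    linarith [dist_triangle_right v z (c n)]
  have hne : ∀ (χ : X → Y) (V : Set X) (O : Set Y), O.Nonempty → O ⊆ closure (χ '' V) →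
      V.Nonempty := fun χ V O hO h => (closure_nonempty_iff.1 (hO.mono h)).of_image
  obtain ⟨z, hz⟩ := key (fun n => (w n).1.1)
    (fun n => hne φ _ _ (w n).2.2.2.2.1 (w n).2.2.2.2.2.1) (fun n => hF1 n (w n))
  obtain ⟨z', hz'⟩ := key (fun n => (w n).1.2.1)
    (fun n => hne ψ _ _ (w n).2.2.2.2.1 (w n).2.2.2.2.2.2) (fun n => hF2 n (w n))
  refine ⟨z, z', by_contra fun hzz => ?_⟩
  obtain ⟨V, V', hV, hV', hzV, hzV', hdisj⟩ := t2_separation hzz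
  obtain ⟨n, hn⟩ := hz _ ((hV.preimage hφ).mem_nhds hzV)
  obtain ⟨n', hn'⟩ := hz' _ ((hV'.preimage hψ).mem_nhds hzV')
  obtain ⟨-, -, hO, ⟨y, hy⟩, h1, h2⟩ := (w (max n n')).2
  obtain ⟨v, hvO, hvV⟩ := mem_closure_iff.1 (closure_mono
    (Set.image_subset_iff.2 (hn _ (le_max_left n n'))) (h1 hy)) _ hO hy
  obtain ⟨v', hv', hvV'⟩ := mem_closure_iff.1 (closure_mono
    (Set.image_subset_iff.2 (hn' _ (le_max_right n n'))) (h2 hvO)) _ hV hvV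
  exact hdisj.le_bot ⟨hv', hvV'⟩

end SomewhereDense

/-! ### The topology of pointwise convergence -/

section PointwiseTopology

open Topology

variable {U : Type*} [MetricSpace U]

/-- The topology of pointwise convergence on the isometry group. Inversion is continuous for it,
since `dist (k⁻¹ x) (g⁻¹ x) = dist x (k (g⁻¹ x))`. -/
instance IsometryEquiv.instTopologicalSpacePointwise : TopologicalSpace (U ≃ᵢ U) :=
  TopologicalSpace.induced (fun g => (g : U → U)) Pi.topologicalSpace

theorem IsometryEquiv.continuous_iff_pointwise {T : Type*} [TopologicalSpace T]
    {F : T → U ≃ᵢ U} : Continuous F ↔ ∀ x, Continuous fun t => F t x := by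
  rw [continuous_induced_rng, continuous_pi_iff]
  rfl

theorem IsometryEquiv.continuous_eval_const (x : U) : Continuous fun g : U ≃ᵢ U => g x :=
  IsometryEquiv.continuous_iff_pointwise.1 continuous_id x

instance : T2Space (U ≃ᵢ U) :=
  T2Space.of_injective_continuous (f := fun g : U ≃ᵢ U => (g : U → U)) DFunLike.coe_injective
    continuous_induced_dom

/-- Evaluation is jointly continuous, because isometries are equicontinuous. -/
theorem IsometryEquiv.continuous_apply {T : Type*} [TopologicalSpace T] {F : T → U ≃ᵢ U}
    (hF : Continuous F) {v : T → U} (hv : Continuous v) : Continuous fun t => F t (v t) := by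
  rw [continuous_iff_continuousAt]
  intro t
  rw [ContinuousAt, tendsto_iff_dist_tendsto_zero]
  have h1 : Filter.Tendsto (fun s => dist (v s) (v t) + dist (F s (v t)) (F t (v t))) (𝓝 t)
      (𝓝 (0 + 0)) :=
    (tendsto_iff_dist_tendsto_zero.1 (hv.tendsto t)).add
      (tendsto_iff_dist_tendsto_zero.1
        ((IsometryEquiv.continuous_iff_pointwise.1 hF (v t)).tendsto t))
  rw [add_zero] at h1
  refine squeeze_zero (fun _ => dist_nonneg) (fun s => ?_) h1
  have := dist_triangle (F s (v s)) (F s (v t)) (F t (v t))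
  rwa [(F s).dist_eq] at this

instance : IsTopologicalGroup (U ≃ᵢ U) where
  continuous_mul := IsometryEquiv.continuous_iff_pointwise.2 fun x =>
    IsometryEquiv.continuous_apply continuous_fst
      ((IsometryEquiv.continuous_eval_const x).comp continuous_snd)
  continuous_inv := IsometryEquiv.continuous_iff_pointwise.2 fun x => by
    rw [continuous_iff_continuousAt]
    intro g
    rw [ContinuousAt, tendsto_iff_dist_tendsto_zero]
    have h := tendsto_iff_dist_tendsto_zero.1
      ((IsometryEquiv.continuous_eval_const (g⁻¹ x)).tendsto g)
    refine h.congr fun k => ?_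
    rw [← k.dist_eq (k⁻¹ x), IsometryEquiv.apply_inv_self, IsometryEquiv.apply_inv_self, dist_comm]

theorem IsometryEquiv.mem_nhds_iff {g : U ≃ᵢ U} {W : Set (U ≃ᵢ U)} :
    W ∈ 𝓝 g ↔ ∃ (A : Set U) (ε : ℝ), A.Finite ∧ 0 < ε ∧
      ∀ h : U ≃ᵢ U, (∀ x ∈ A, dist (h x) (g x) < ε) → h ∈ W := by
  constructor
  · intro hW
    rw [nhds_induced, Filter.mem_comap] at hW
    obtain ⟨V, hV, hVW⟩ := hW
    rw [nhds_pi, Filter.mem_pi] at hV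
    obtain ⟨A, hA, t, ht, htV⟩ := hV
    choose ε hε hεt using fun x => Metric.mem_nhds_iff.1 (ht x)
    obtain ⟨δ, hδ, hδA⟩ : ∃ δ > 0, ∀ x ∈ A, δ ≤ ε x := by
      rcases A.eq_empty_or_nonempty with rfl | hne
      · exact ⟨1, one_pos, fun x hx => hx.elim⟩
      · obtain ⟨x, hx, hmin⟩ := Set.exists_min_image A ε hA hne
        exact ⟨ε x, hε x, hmin⟩
    exact ⟨A, δ, hA, hδ, fun h hh => hVW (htV fun x hx => hεt x ((hh x hx).trans_le (hδA x hx)))⟩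
  · rintro ⟨A, ε, hA, hε, h⟩
    have : ∀ᶠ k : U ≃ᵢ U in 𝓝 g, ∀ x ∈ A, dist (k x) (g x) < ε :=
      (Filter.eventually_all_finite hA).2 fun x _ =>
        (IsometryEquiv.continuous_eval_const x).tendsto g (Metric.ball_mem_nhds _ hε)
    exact Filter.mem_of_superset this h

/-- The isometry group of a nonempty complete separable metric space is completely metrizable: it is
homeomorphic to a closed set of pairs of sequences, via the values of `g` and of
`g⁻¹` at a dense sequence. -/
instance [CompleteSpace U] [TopologicalSpace.SeparableSpace U] [Nonempty U] :
    TopologicalSpace.IsCompletelyMetrizableSpace (U ≃ᵢ U) := by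
  let u := TopologicalSpace.denseSeq U
  have hu : DenseRange u := TopologicalSpace.denseRange_denseSeq U
  let Φ : (U ≃ᵢ U) → (ℕ → U) × (ℕ → U) := fun g => (fun n => g (u n), fun n => g⁻¹ (u n))
  have hcont : Continuous Φ :=
    (continuous_pi fun n => IsometryEquiv.continuous_eval_const (u n)).prodMk
      (continuous_pi fun n => (IsometryEquiv.continuous_eval_const (u n)).comp continuous_inv)
  have hinj : Function.Injective Φ := fun g h hgh => DFunLike.coe_injective
    (hu.equalizer g.continuous h.continuous (congrArg Prod.fst hgh))
  have hind : IsInducing Φ := by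
    refine isInducing_iff_nhds.2 fun g =>
      le_antisymm (hcont.tendsto g).le_comap fun W hW => ?_
    obtain ⟨A, ε, hA, hε, hW⟩ := IsometryEquiv.mem_nhds_iff.1 hW
    choose n hn using fun x => Metric.denseRange_iff.1 hu x (ε / 3) (by positivity)
    refine Filter.mem_comap.2 ⟨{a | ∀ x ∈ A, dist (a.1 (n x)) (g (u (n x))) < ε / 3}, ?_,
      fun h hh => hW h fun x hx => ?_⟩
    · refine (Filter.eventually_all_finite hA).2 fun x _ => ?_
      have hev : Continuous fun a : (ℕ → U) × (ℕ → U) => a.1 (n x) := by fun_prop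
      exact hev.tendsto (Φ g) (Metric.ball_mem_nhds _ (by positivity))
    · have e1 := dist_triangle4 (h x) (h (u (n x))) (g (u (n x))) (g x)
      rw [h.dist_eq, g.dist_eq] at e1
      have e2 : dist (h (u (n x))) (g (u (n x))) < ε / 3 := hh x hx
      linarith [hn x, dist_comm x (u (n x))]
  have hrange : Set.range Φ = {a | ∀ i j, dist (a.1 i) (a.1 j) = dist (u i) (u j) ∧
      dist (a.2 i) (a.2 j) = dist (u i) (u j) ∧ dist (a.1 i) (u j) = dist (u i) (a.2 j)} := by
    ext ⟨a, b⟩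
    constructor
    · rintro ⟨g, hg⟩ i j
      obtain ⟨rfl, rfl⟩ := Prod.mk.inj hg
      refine ⟨g.dist_eq _ _, g⁻¹.dist_eq _ _, ?_⟩
      rw [← g.dist_eq (u i), IsometryEquiv.apply_inv_self]
    · intro h
      have hR : IsometricRel (Set.range (fun n => (u n, a n)) ∪ Set.range fun n => (b n, u n)) := by
        rintro _ (⟨i, rfl⟩ | ⟨i, rfl⟩) _ (⟨j, rfl⟩ | ⟨j, rfl⟩)
        · exact (h i j).1.symm
        · exact (h i j).2.2.symm
        · have := (h j i).2.2
          simp only at this ⊢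
          rw [dist_comm, ← this, dist_comm]
        · exact (h i j).2.1
      obtain ⟨g, hg⟩ := hR.exists_isometryEquiv
        (hu.mono (by
          rintro _ ⟨n, rfl⟩
          exact ⟨_, Or.inl ⟨n, rfl⟩, rfl⟩))
        (hu.mono (by
          rintro _ ⟨n, rfl⟩
          exact ⟨_, Or.inr ⟨n, rfl⟩, rfl⟩))
      refine ⟨g, Prod.ext (funext fun n => hg _ (Or.inl ⟨n, rfl⟩)) (funext fun n => ?_)⟩
      have := hg _ (Or.inr ⟨n, rfl⟩)
      exact g.symm_apply_eq.2 this.symm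
  have hclosed : IsClosed (Set.range Φ) := by
    rw [hrange]
    simp only [Set.ofPred_forall, Set.ofPred_and]
    refine isClosed_iInter fun i => isClosed_iInter fun j => ?_
    refine (isClosed_eq ?_ ?_).inter ((isClosed_eq ?_ ?_).inter (isClosed_eq ?_ ?_)) <;> fun_prop
  exact (IsClosedEmbedding.mk ⟨hind, hinj⟩ hclosed).IsCompletelyMetrizableSpace

end PointwiseTopology

/-! ### Simplicity -/

section Simplicity

open Topology

variable {U : Type*} [MetricSpace U]

/-- The product of the conjugates of `t`, `t` and `t⁻¹` by three given isometries. -/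
def conjProduct (t : U ≃ᵢ U) (h : (U ≃ᵢ U) × (U ≃ᵢ U) × (U ≃ᵢ U)) : U ≃ᵢ U :=
  (h.2.2 * t * h.2.2⁻¹)⁻¹ * (h.2.1 * t * h.2.1⁻¹) * (h.1 * t * h.1⁻¹)

theorem continuous_conjProduct (t : U ≃ᵢ U) : Continuous (conjProduct t) := by
  unfold conjProduct
  fun_prop

theorem conjProduct_mem {N : Subgroup (U ≃ᵢ U)} [hN : N.Normal] {t : U ≃ᵢ U} (ht : t ∈ N)
    (h : (U ≃ᵢ U) × (U ≃ᵢ U) × (U ≃ᵢ U)) : conjProduct t h ∈ N :=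
  N.mul_mem (N.mul_mem (N.inv_mem (hN.conj_mem t ht _)) (hN.conj_mem t ht _)) (hN.conj_mem t ht _)

/-- The case of `exists_conj_mul_eq_on` without constraints on the conjugating isometries. -/
theorem denseRange_conjProduct (hU : ∀ x y : U, dist x y ≤ 1) (hE : ExtensionProperty U)
    (hH : IsUltrahomogeneousMetric U) {t : U ≃ᵢ U} (ht : ∀ x, dist x (t x) = 1) :
    DenseRange (conjProduct t) := by
  intro f
  rw [mem_closure_iff_nhds]
  intro W hW
  obtain ⟨C, ε, hC, hε, hW⟩ := IsometryEquiv.mem_nhds_iff.1 hW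
  obtain ⟨k, k', l, hkl, -⟩ := exists_conj_mul_eq_on hU hE hH t t t ht ht ht Set.finite_empty
    (by simp [IsIndependent]) zero_le_one f (by simp) hC
  refine ⟨_, hW (conjProduct t (k, k', l)) fun x hx => ?_, ⟨_, rfl⟩⟩
  rw [← hkl x hx]
  exact (dist_self _).trans_lt hε

/-- The conjugating isometries `h` are varied by applying `exists_conj_somewhere_dense` to the
conjugates `h * t * h⁻¹`: replacing `h` by `k * h` moves its values on `A` by as much as `k` moves
the points of `h A`. -/
theorem interior_closure_conjProduct_nonempty (hU : ∀ x y : U, dist x y ≤ 1)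
    (hE : ExtensionProperty U) (hH : IsUltrahomogeneousMetric U) {t : U ≃ᵢ U}
    (ht : ∀ x, dist x (t x) = 1) {W : Set ((U ≃ᵢ U) × (U ≃ᵢ U) × (U ≃ᵢ U))} (hW : IsOpen W)
    (hne : W.Nonempty) : (interior (closure (conjProduct t '' W))).Nonempty := by
  obtain ⟨⟨h₁, h₂, h₃⟩, hh⟩ := hne
  obtain ⟨W₁, hW₁, W', hW', hsub⟩ := mem_nhds_prod_iff.1 (hW.mem_nhds hh)
  obtain ⟨W₂, hW₂, W₃, hW₃, hsub'⟩ := mem_nhds_prod_iff.1 hW'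
  obtain ⟨A₁, ε₁, hA₁, hε₁, hW₁⟩ := IsometryEquiv.mem_nhds_iff.1 hW₁
  obtain ⟨A₂, ε₂, hA₂, hε₂, hW₂⟩ := IsometryEquiv.mem_nhds_iff.1 hW₂
  obtain ⟨A₃, ε₃, hA₃, hε₃, hW₃⟩ := IsometryEquiv.mem_nhds_iff.1 hW₃
  obtain ⟨ε, hε, hε'⟩ := exists_between (lt_min hε₁ (lt_min hε₂ hε₃))
  obtain ⟨p, S, δ, hS, hδ, hp⟩ := exists_conj_somewhere_dense hU hE hH (h₁ * t * h₁⁻¹)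
    (h₂ * t * h₂⁻¹) (h₃ * t * h₃⁻¹) (dist_conj_eq_one ht h₁) (dist_conj_eq_one ht h₂)
    (dist_conj_eq_one ht h₃) ((hA₁.image h₁).union ((hA₂.image h₂).union (hA₃.image h₃))) hε
  refine ⟨p, mem_interior_iff_mem_nhds.2 (Filter.mem_of_superset
    (IsometryEquiv.mem_nhds_iff.2 ⟨S, δ, hS, hδ, fun f hf => hf⟩) fun f hf => ?_)⟩
  rw [mem_closure_iff_nhds]
  intro V hV
  obtain ⟨C, η, hC, hη, hV⟩ := IsometryEquiv.mem_nhds_iff.1 hV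
  obtain ⟨k, k', l, hkl, hk, hk', hl⟩ := hp f hf C hC
  refine ⟨conjProduct t (k * h₁, k' * h₂, l * h₃), hV _ fun x hx => ?_, _,
    hsub ⟨hW₁ _ fun x hx => ?_, hsub' ⟨hW₂ _ fun x hx => ?_, hW₃ _ fun x hx => ?_⟩⟩, rfl⟩
  · rw [← hkl x hx]
    refine (le_of_eq ?_).trans_lt hη
    simp only [conjProduct, mul_inv_rev, mul_assoc, dist_self]
  · exact (hk _ (Or.inl ⟨x, hx, rfl⟩)).trans_lt (hε'.trans_le (min_le_left _ _))
  · exact (hk' _ (Or.inr (Or.inl ⟨x, hx, rfl⟩))).trans_lt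
      (hε'.trans_le ((min_le_right _ _).trans (min_le_left _ _)))
  · exact (hl _ (Or.inr (Or.inr ⟨x, hx, rfl⟩))).trans_lt
      (hε'.trans_le ((min_le_right _ _).trans (min_le_right _ _)))

/-- `conjProduct t` and its left translate by `f` have a common value. -/
theorem exists_eq_conjProduct_div [CompleteSpace U] [TopologicalSpace.SeparableSpace U] [Nonempty U]
    (hU : ∀ x y : U, dist x y ≤ 1) (hE : ExtensionProperty U)
    (hH : IsUltrahomogeneousMetric U) {t : U ≃ᵢ U} (ht : ∀ x, dist x (t x) = 1) (f : U ≃ᵢ U) :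
    ∃ h h', f = conjProduct t h / conjProduct t h' := by
  let _ := TopologicalSpace.upgradeIsCompletelyMetrizable ((U ≃ᵢ U) × (U ≃ᵢ U) × (U ≃ᵢ U))
  have hc := continuous_conjProduct t
  obtain ⟨h, h', hh⟩ := exists_eq_of_somewhere_dense (φ := conjProduct t)
    (ψ := fun h => f * conjProduct t h) hc (continuous_const.mul hc)
    (denseRange_conjProduct hU hE hH ht)
    ((Homeomorph.mulLeft f).surjective.denseRange.comp (denseRange_conjProduct hU hE hH ht)
      (Homeomorph.mulLeft f).continuous)
    (fun W hW hne => interior_closure_conjProduct_nonempty hU hE hH ht hW hne)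
    (fun W hW hne => by
      have h := (interior_closure_conjProduct_nonempty hU hE hH ht hW hne).image
        (Homeomorph.mulLeft f)
      rw [Homeomorph.image_interior, Homeomorph.image_closure, Set.image_image] at h
      exact h)
  exact ⟨h, h', by rw [hh, mul_div_cancel_right]⟩

end Simplicity

/-- The bounded Urysohn space of diameter `1` exists, and its isometry group (for any model of it)
is simple as an abstract group. -/
theorem theorem1 :
    (∃ (U : Type) (_ : MetricSpace U), IsBoundedUrysohnSpace U) ∧
      ∀ (U : Type*) [MetricSpace U], IsBoundedUrysohnSpace U → IsSimpleGroup (U ≃ᵢ U) := by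
  refine ⟨exists_isBoundedUrysohnSpace, fun U _ hUr => ?_⟩
  have := hUr.complete
  have := hUr.separable
  have hU := hUr.dist_le_one
  obtain ⟨a, b, hab⟩ : ∃ a b : U, a ≠ b := by
    by_contra! h
    have := hUr.diam_eq_one
    rw [Metric.diam_subsingleton fun x _ y _ => h x y] at this
    exact zero_ne_one this
  have : Nonempty U := ⟨a⟩
  obtain ⟨g, hg⟩ := hUr.homogeneous {a} (fun _ => b) (Set.finite_singleton a)
    (isometry_subsingleton)
  refine
    { exists_pair_ne := ⟨g, 1, fun h => hab ?_⟩
      eq_bot_or_eq_top_of_normal := fun N hN => or_iff_not_imp_left.2 fun hne => ?_ }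
  · rw [← hg ⟨a, rfl⟩, h]
    rfl
  · obtain ⟨t, htN, ht⟩ := exists_mem_normal_dist_eq_one hU hUr.extensionProperty N hne
    refine (Subgroup.eq_top_iff' N).2 fun f => ?_
    obtain ⟨h, h', rfl⟩ := exists_eq_conjProduct_div hU hUr.extensionProperty hUr.homogeneous ht f
    exact N.div_mem (conjProduct_mem htN h) (conjProduct_mem htN h')
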